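/- Let $q\in\mathbb C$ with $0<|q|<1$. Write $(x;q)_n=\prod_{k=0}^{n-1}(1-xq^k)$, $(x;q)_\infty=\prod_{k\ge 0}(1-xq^k)$, $(x_1,\dots,x_m;q)_n=\prod_{i}(x_i;q)_n$ for $n\in\mathbb N\cup\{\infty\}$, and $$\Delta(u,v)=v\,(q,u/v,qv/u;q)_\infty,\qquad {}_3\phi_2\left({a_1,a_2,a_3\atop b_1,b_2};q,z\right)=\sum_{k=0}^\infty\frac{(a_1,a_2,a_3;q)_k}{(q,b_1,b_2;q)_k}z^k .$$ For complex numbers $a,b,c,d,r,u,v$ put $$\rho(a,b,c,d,r,u,v)=v\sum_{n=0}^\infty\frac{(q/du,\,acuv,\,bcuv;q)_n(dv)^n}{(av,bv,cv;q)_{n+1}}\;{}_3\phi_2\left({q^{n+1},\ vq^{n+1}/r,\ q/cu\atop avq^{n+1},\ bvq^{n+1}};q,\frac{abcruv}{q}\right).$$ If $c$, $d$ or $r$ is $0$, the terms are understood by their limit values, that is, $(q/du;q)_n(dv)^n=\prod_{j<n}(dv-q^{j+1}v/u)$, $(vq^{n+1}/r;q)_k\,r^k=\prod_{j<k}(r-vq^{n+1+j})$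 and $(q/cu;q)_k(cu)^k=\prod_{j<k}(cu-q^{j+1})$. Let $a,b,c,d,u,v\in\mathbb C$ satisfy $uv\ne 0$ and $$\max\{|au|,|av|,|bu|,|bv|,|cu|,|cv|,|du|,|dv|,|abcdu^2v^2/q|\}<1 .$$ Then the inner and outer series in $\rho(a,b,c,d,duv,u,v)$ and $\rho(a,b,c,d,duv,v,u)$ converge absolutely, and $$\rho(a,b,c,d,duv,u,v)-\rho(a,b,c,d,duv,v,u)=\frac{\Delta(u,v)\,(abuv,acuv,aduv,bcuv,bduv,cduv;q)_\infty}{(au,av,bu,bv,cu,cv,du,dv,abcdu^2v^2/q;q)_\infty}.$$ -/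

import Mathlib

/-- The finite `q`-shifted factorial `(a; q)_n = ∏_{k < n} (1 - a q^k)`. -/
def qPoch (a q : ℂ) (n : ℕ) : ℂ :=
  ∏ k ∈ Finset.range n, (1 - a * q ^ k)

/-- The infinite `q`-shifted factorial `(a; q)_∞ = ∏_{k ≥ 0} (1 - a q^k)`. -/
noncomputable def qPochInf (a q : ℂ) : ℂ :=
  ∏' k : ℕ, (1 - a * q ^ k)

/-- For `|q| < 1` the product defining `(a; q)_∞` converges. -/
theorem multipliable_qPochInf (a : ℂ) {q : ℂ} (hq : ‖q‖ < 1) :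
    Multipliable (fun k : ℕ => 1 - a * q ^ k) := by
  have h : Summable (fun k : ℕ => ‖-(a * q ^ k)‖) := by
    simpa [norm_mul, norm_pow] using
      (summable_geometric_of_lt_one (norm_nonneg q) hq).mul_left ‖a‖
  simpa [sub_eq_add_neg] using multipliable_one_add_of_summable h

/-- The multiple factorial `(a₁, …, a_m; q)_n = (a₁; q)_n ⋯ (a_m; q)_n`. -/
def qPochs (as : List ℂ) (q : ℂ) (n : ℕ) : ℂ :=
  (as.map fun a => qPoch a q n).prod

/-- The multiple factorial `(a₁, …, a_m; q)_∞ = (a₁; q)_∞ ⋯ (a_m; q)_∞`. -/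
noncomputable def qPochsInf (as : List ℂ) (q : ℂ) : ℂ :=
  (as.map fun a => qPochInf a q).prod

/-- The theta function `Δ(u, v) = v (q, u/v, qv/u; q)_∞`. -/
noncomputable def thetaDelta (q u v : ℂ) : ℂ :=
  v * qPochsInf [q, u / v, q * v / u] q

/-- The `n`-th term of the basic hypergeometric series `_rφ_s(as; bs; q, z)`. -/
noncomputable def phiTerm (as bs : List ℂ) (q z : ℂ) (n : ℕ) : ℂ :=
  qPochs as q n / qPochs (q :: bs) q n
    * ((-1) ^ n * q ^ (n * (n - 1) / 2)) ^ (1 + (bs.length : ℤ) - (as.length : ℤ))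
    * z ^ n

/-- The basic hypergeometric series `_rφ_s(as; bs; q, z)`. -/
noncomputable def phi (as bs : List ℂ) (q z : ℂ) : ℂ :=
  ∑' n : ℕ, phiTerm as bs q z n

/-- The `k`-th term of the inner series
`₃φ₂(q^{n+1}, v q^{n+1}/r, q/(cu); a v q^{n+1}, b v q^{n+1}; q, abcruv/q)` of `ρ`. -/
noncomputable def rhoInnerTerm (q a b c r u v : ℂ) (n k : ℕ) : ℂ :=
  phiTerm [q ^ (n + 1), v * q ^ (n + 1) / r, q / (c * u)]
    [a * v * q ^ (n + 1), b * v * q ^ (n + 1)] q (a * b * c * r * u * v / q) k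

/-- The `n`-th term of the outer series of `ρ`. -/
noncomputable def rhoTerm (q a b c d r u v : ℂ) (n : ℕ) : ℂ :=
  qPochs [q / (d * u), a * c * u * v, b * c * u * v] q n * (d * v) ^ n
      / qPochs [a * v, b * v, c * v] q (n + 1)
    * phi [q ^ (n + 1), v * q ^ (n + 1) / r, q / (c * u)]
        [a * v * q ^ (n + 1), b * v * q ^ (n + 1)] q (a * b * c * r * u * v / q)

/-- The double series `ρ(a, b, c, d, r, u, v)`, for nonzero `c, d, r, u`. -/
noncomputable def rho (q a b c d r u v : ℂ) : ℂ :=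
  v * ∑' n : ℕ, rhoTerm q a b c d r u v n

/-- The product `∏_{k < n} (x - y q^k)`. It is `(y/x; q)_n x^n` if `x ≠ 0`, and gives that
expression its limit value if `x = 0`. -/
def homPoch (x y q : ℂ) (n : ℕ) : ℂ :=
  ∏ k ∈ Finset.range n, (x - y * q ^ k)

theorem homPoch_eq {x : ℂ} (hx : x ≠ 0) (y q : ℂ) (n : ℕ) :
    homPoch x y q n = qPoch (y / x) q n * x ^ n := by
  rw [homPoch, qPoch, ← Finset.card_range n, ← Finset.prod_const, Finset.card_range,
    ← Finset.prod_mul_distrib]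
  refine Finset.prod_congr rfl fun k _ => ?_
  field_simp

/-- `rhoInnerTerm` with `(v q^{n+1}/r; q)_k r^k` and `(q/(cu); q)_k (cu)^k` written as products
that make sense for `r = 0` and for `c = 0`. -/
noncomputable def rhoExtInnerTerm (q a b c r u v : ℂ) (n k : ℕ) : ℂ :=
  qPoch (q ^ (n + 1)) q k * homPoch r (v * q ^ (n + 1)) q k * homPoch (c * u) q q k
      / qPochs [q, a * v * q ^ (n + 1), b * v * q ^ (n + 1)] q k
    * (a * b * v / q) ^ k

/-- `rhoTerm` with `(q/(du); q)_n (dv)^n` also written as a product that makes sense for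
`d = 0`. -/
noncomputable def rhoExtTerm (q a b c d r u v : ℂ) (n : ℕ) : ℂ :=
  homPoch (d * v) (q * v / u) q n * qPochs [a * c * u * v, b * c * u * v] q n
      / qPochs [a * v, b * v, c * v] q (n + 1)
    * ∑' k : ℕ, rhoExtInnerTerm q a b c r u v n k

/-- The double series `ρ(a, b, c, d, r, u, v)`, extended by limit values of its terms to the
cases where `c`, `d` or `r` is `0`. -/
noncomputable def rhoExt (q a b c d r u v : ℂ) : ℂ :=
  v * ∑' n : ℕ, rhoExtTerm q a b c d r u v n

theorem rhoExtInnerTerm_eq {c r u : ℂ} (hc : c ≠ 0) (hr : r ≠ 0) (hu : u ≠ 0)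
    (q a b v : ℂ) (n k : ℕ) :
    rhoExtInnerTerm q a b c r u v n k = rhoInnerTerm q a b c r u v n k := by
  have h : a * b * c * r * u * v / q = r * (c * u) * (a * b * v / q) := by ring
  rw [rhoExtInnerTerm, rhoInnerTerm, phiTerm, homPoch_eq hr, homPoch_eq (mul_ne_zero hc hu), h,
    mul_pow, mul_pow]
  simp only [qPochs, List.map_cons, List.map_nil, List.prod_cons, List.prod_nil,
    List.length_cons, List.length_nil]
  norm_num
  ring

theorem rhoExtTerm_eq {c d r u v : ℂ} (hc : c ≠ 0) (hd : d ≠ 0) (hr : r ≠ 0) (hu : u ≠ 0)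
    (hv : v ≠ 0) (q a b : ℂ) (n : ℕ) :
    rhoExtTerm q a b c d r u v n = rhoTerm q a b c d r u v n := by
  have h : q * v / u / (d * v) = q / (d * u) := by field_simp
  rw [rhoExtTerm, rhoTerm, homPoch_eq (mul_ne_zero hd hv), h, phi]
  simp only [rhoExtInnerTerm_eq hc hr hu, rhoInnerTerm, qPochs, List.map_cons, List.map_nil,
    List.prod_cons, List.prod_nil]
  ring

/-- The extended series agrees with `ρ` wherever the latter is defined. -/
theorem rhoExt_eq {c d r u v : ℂ} (hc : c ≠ 0) (hd : d ≠ 0) (hr : r ≠ 0) (hu : u ≠ 0)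
    (hv : v ≠ 0) (q a b : ℂ) :
    rhoExt q a b c d r u v = rho q a b c d r u v := by
  simp only [rhoExt, rho, rhoExtTerm_eq hc hd hr hu hv]

open Filter Topology Finset

/-! The choice `r = duv` makes `v q^{n+1}/r` equal to `q^{n+1}/(du)`, so that `(q/du; q)_n` and
`(q^{n+1}/(du); q)_k` merge into `(q/du; q)_{n+k}`; the denominators in `av` and `bv` merge in the
same way. Summed along `n + k = N`, the double series becomes a Newton-type expansion in `D = dv`
with nodes `q^{j+1}/x`, `x = u/v`, whose coefficients do not involve `d`.

After the rescaling `a, b, c ↦ av, bv, cv`, these coefficients satisfy a relation between `a` and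
`aq` (`newtonCoeff_recurrence`), and telescoping in `N` turns it into a first-order inhomogeneous
relation for the sum (`newtonTerm_recurrence`). Multiplied by `v`, its inhomogeneous part is `-auv`,
and its coefficients are also symmetric in `u` and `v`. Hence the difference under `u ↔ v` satisfies
a homogeneous relation (`newtonDiff_recurrence`).

Iterating `a ↦ aq` and letting `a q^M → 0` splits off the infinite products containing `a`. Symmetry
in `a, b` does the same for `b`; simpler relations at `a = b = 0` and at `a = b = c = 0` remove `c`
and then `d`. The value left at `a = b = c = d = 0` is found by running the `d` step backwards from
`d = q/u`, where one series terminates and the other telescopes; it is `Δ(u, v)`. One summable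
majorant, uniform over smaller parameters, justifies the regrouping and all these limits. -/

/-! ### Finite q-factorials and Gaussian binomials -/

theorem qPoch_zero (a q : ℂ) : qPoch a q 0 = 1 := by simp [qPoch]

theorem qPoch_succ (a q : ℂ) (n : ℕ) : qPoch a q (n + 1) = qPoch a q n * (1 - a * q ^ n) :=
  Finset.prod_range_succ _ _

theorem qPoch_succ' (a q : ℂ) (n : ℕ) :
    qPoch a q (n + 1) = (1 - a) * qPoch (a * q) q n := by
  rw [qPoch, Finset.prod_range_succ', qPoch, mul_comm]
  congr 1
  · simp
  · exact Finset.prod_congr rfl fun k _ => by ring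

theorem qPoch_add (a q : ℂ) (n k : ℕ) :
    qPoch a q (n + k) = qPoch a q n * qPoch (a * q ^ n) q k := by
  rw [qPoch, Finset.prod_range_add, qPoch, qPoch]
  congr 1
  exact Finset.prod_congr rfl fun j _ => by ring

theorem qPoch_zero_left (q : ℂ) (n : ℕ) : qPoch 0 q n = 1 := by simp [qPoch]

theorem qPoch_ne_zero {a q : ℂ} (h : ∀ j : ℕ, a * q ^ j ≠ 1) (n : ℕ) : qPoch a q n ≠ 0 :=
  Finset.prod_ne_zero_iff.2 fun k _ => sub_ne_zero.2 (h k).symm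

theorem homPoch_zero (x y q : ℂ) : homPoch x y q 0 = 1 := by simp [homPoch]

theorem homPoch_succ (x y q : ℂ) (n : ℕ) :
    homPoch x y q (n + 1) = homPoch x y q n * (x - y * q ^ n) :=
  Finset.prod_range_succ _ _

theorem homPoch_add (x y q : ℂ) (n k : ℕ) :
    homPoch x y q (n + k) = homPoch x y q n * homPoch x (y * q ^ n) q k := by
  rw [homPoch, Finset.prod_range_add, homPoch, homPoch]
  congr 1
  exact Finset.prod_congr rfl fun j _ => by ring

theorem homPoch_mul_left (s x y q : ℂ) (n : ℕ) :
    homPoch (s * x) (s * y) q n = s ^ n * homPoch x y q n := by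
  rw [homPoch, homPoch, ← Finset.card_range n, ← Finset.prod_const, Finset.card_range,
    ← Finset.prod_mul_distrib]
  exact Finset.prod_congr rfl fun j _ => by ring

/-- The Gaussian binomial coefficient `(q^{n+1}; q)_k / (q; q)_k`. -/
noncomputable def gaussBinom (q : ℂ) (n k : ℕ) : ℂ :=
  qPoch (q ^ (n + 1)) q k / qPoch q q k

theorem mul_pow_ne_one {a q : ℂ} (ha : ‖a‖ < 1) (hq : ‖q‖ < 1) (j : ℕ) : a * q ^ j ≠ 1 := by
  intro h
  have h1 : ‖a * q ^ j‖ = 1 := by rw [h, norm_one]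
  rw [norm_mul, norm_pow] at h1
  have h2 : ‖q‖ ^ j ≤ 1 := pow_le_one₀ (norm_nonneg _) hq.le
  nlinarith [norm_nonneg a, norm_nonneg q]

theorem pow_succ_ne_one {q : ℂ} (hq : ‖q‖ < 1) (j : ℕ) : 1 - q ^ (j + 1) ≠ 0 := by
  have := mul_pow_ne_one hq hq j
  rw [sub_ne_zero]
  rw [pow_succ']
  exact this.symm

theorem gaussBinom_eq {q : ℂ} (hq : ‖q‖ < 1) (n k : ℕ) :
    gaussBinom q n k = qPoch q q (n + k) / (qPoch q q n * qPoch q q k) := by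
  have h := qPoch_ne_zero (mul_pow_ne_one hq hq)
  rw [gaussBinom, qPoch_add, pow_succ']
  have := h n
  have := h k
  field_simp

theorem gaussBinom_zero_right (q : ℂ) (n : ℕ) : gaussBinom q n 0 = 1 := by
  simp [gaussBinom, qPoch_zero]

theorem gaussBinom_succ_left {q : ℂ} (hq : ‖q‖ < 1) (n k : ℕ) :
    gaussBinom q (n + 1) k =
      gaussBinom q n k * ((1 - q ^ (n + k + 1)) / (1 - q ^ (n + 1))) := by
  have h := qPoch_ne_zero (mul_pow_ne_one hq hq)
  have h1 := h n
  have h2 := h k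
  have h3 := pow_succ_ne_one hq n
  rw [gaussBinom_eq hq, gaussBinom_eq hq, add_right_comm, qPoch_succ, qPoch_succ,
    ← pow_succ', ← pow_succ']
  field_simp

theorem gaussBinom_succ_right {q : ℂ} (hq : ‖q‖ < 1) (n k : ℕ) :
    gaussBinom q n (k + 1) =
      gaussBinom q n k * ((1 - q ^ (n + k + 1)) / (1 - q ^ (k + 1))) := by
  have h := qPoch_ne_zero (mul_pow_ne_one hq hq)
  have h1 := h n
  have h2 := h k
  have h3 := pow_succ_ne_one hq k
  rw [gaussBinom_eq hq, gaussBinom_eq hq, ← add_assoc, qPoch_succ, qPoch_succ,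
    ← pow_succ', ← pow_succ']
  field_simp

/-! ### Newton coefficients and their recurrence -/

/-- The summand of the coefficients of `ρ` in the Newton basis `homPoch D (q / x) q`. -/
noncomputable def newtonSummand (q a b c x : ℂ) (n k : ℕ) : ℂ :=
  qPoch (a * c * x) q n * qPoch (b * c * x) q n / qPoch c q (n + 1) * gaussBinom q n k
    * homPoch (c * x) q q k * (a * b * x / q) ^ k

/-- The coefficients of `ρ` in the Newton basis, up to the factor `(a, b; q)_{N+1}`. -/
noncomputable def newtonCoeff (q a b c x : ℂ) (N : ℕ) : ℂ :=
  ∑ p ∈ antidiagonal N, newtonSummand q a b c x p.1 p.2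

theorem newtonSummand_swap (q a b c x : ℂ) (n k : ℕ) :
    newtonSummand q a b c x n k = newtonSummand q b a c x n k := by
  simp only [newtonSummand, mul_comm a b, mul_comm (qPoch (a * c * x) q n)]

theorem newtonCoeff_swap (q a b c x : ℂ) (N : ℕ) :
    newtonCoeff q a b c x N = newtonCoeff q b a c x N :=
  Finset.sum_congr rfl fun _ _ => newtonSummand_swap ..

theorem newtonSummand_succ_left {q c : ℂ} (hq : ‖q‖ < 1) (hc : ‖c‖ < 1) (a b x : ℂ) (n k : ℕ) :
    newtonSummand q a b c x (n + 1) k = newtonSummand q a b c x n k *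
      ((1 - a * c * x * q ^ n) * (1 - b * c * x * q ^ n) / (1 - c * q ^ (n + 1))
        * ((1 - q ^ (n + k + 1)) / (1 - q ^ (n + 1)))) := by
  have h1 := qPoch_ne_zero (mul_pow_ne_one hc hq) (n + 1)
  have h2 : 1 - c * q ^ (n + 1) ≠ 0 := sub_ne_zero.2 (mul_pow_ne_one hc hq _).symm
  rw [newtonSummand, newtonSummand, gaussBinom_succ_left hq, qPoch_succ c q (n + 1),
    qPoch_succ (a * c * x), qPoch_succ (b * c * x)]
  field_simp

theorem newtonSummand_succ_right {q : ℂ} (hq : ‖q‖ < 1) (a b c x : ℂ) (n k : ℕ) :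
    newtonSummand q a b c x n (k + 1) = newtonSummand q a b c x n k *
      ((1 - q ^ (n + k + 1)) / (1 - q ^ (k + 1)) * (c * x - q ^ (k + 1)) * (a * b * x / q)) := by
  rw [newtonSummand, newtonSummand, gaussBinom_succ_right hq, homPoch_succ, pow_succ' q k]
  ring

theorem newtonSummand_shift (q a b c x : ℂ) (n k : ℕ) :
    (1 - a * c * x) * newtonSummand q (a * q) b c x n k =
      (1 - a * c * x * q ^ n) * q ^ k * newtonSummand q a b c x n k := by
  have h1 : (1 - a * c * x) * qPoch (a * q * c * x) q n =
      qPoch (a * c * x) q n * (1 - a * c * x * q ^ n) := by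
    rw [← qPoch_succ, qPoch_succ']; ring_nf
  have h2 : (a * q * b * x / q) ^ k = q ^ k * (a * b * x / q) ^ k := by
    rw [← mul_pow]; congr 1; ring
  rw [newtonSummand, newtonSummand, h2]
  linear_combination (qPoch (b * c * x) q n / qPoch c q (n + 1) * gaussBinom q n k
    * homPoch (c * x) q q k * (q ^ k * (a * b * x / q) ^ k)) * h1

/-- Two-variable telescoping: `U` is shifted back in `n` and `V` in `k`, and the vanishing
hypotheses kill the boundary terms of the shifts. -/
theorem sum_antidiagonal_succ_split (U V : ℕ → ℕ → ℂ) (N : ℕ) (hU : U 0 (N + 1) = 0)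
    (hV : V (N + 1) 0 = 0) :
    ∑ p ∈ antidiagonal (N + 1), (U p.1 p.2 + V p.1 p.2) =
      ∑ p ∈ antidiagonal N, (U (p.1 + 1) p.2 + V p.1 (p.2 + 1)) := by
  rw [Finset.sum_add_distrib, Finset.sum_add_distrib,
    Finset.Nat.sum_antidiagonal_succ (f := fun p => U p.1 p.2),
    Finset.Nat.sum_antidiagonal_succ' (f := fun p => V p.1 p.2)]
  simp [hU, hV]

theorem newtonCoeff_zero (q a b c x : ℂ) : newtonCoeff q a b c x 0 = 1 / (1 - c) := by
  simp [newtonCoeff, newtonSummand, qPoch, homPoch, gaussBinom]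

/-- A creative-telescoping proof. The part at level `N + 1`, divided into pieces that vanish at `n =
0` and at `k = 0`, is moved to level `N` by `sum_antidiagonal_succ_split`, where it matches the rest
of the identity term by term. -/
theorem newtonCoeff_recurrence {q c : ℂ} (hq0 : q ≠ 0)
    (hq : ‖q‖ < 1) (hc : ‖c‖ < 1)
    (a b x : ℂ) (N : ℕ) :
    (1 - a * x) * (newtonCoeff q a b c x (N + 1) * (1 - a * b * c * x * q ^ (N + 1))
        - a * b * c * x ^ 2 / q * newtonCoeff q a b c x N
          * (1 - a * q ^ (N + 1)) * (1 - b * q ^ (N + 1))) =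
      (1 - a * b * x) * (1 - a * c * x) * (newtonCoeff q (a * q) b c x (N + 1)
        - a * x * (1 - b * q ^ (N + 1)) * newtonCoeff q (a * q) b c x N) := by
  set s := newtonSummand q a b c x with hs
  -- The certificate. The factors `1 - q^n` in `U` and `1 - q^k` in `V` give the boundary zeros;
  -- after the shift they and the denominators `1 - q^{n+k}` cancel against the ratios of
  -- consecutive Gaussian binomials.
  let r : ℕ → ℕ → ℂ := fun n k => -(1 - a * x) + q ^ (n + k) * (1 - a * b * x)
    - a * c * x * (1 - b) * q ^ (n + k) * q ^ n
  let V : ℕ → ℕ → ℂ := fun n k => -(s n k * ((1 - q ^ k) / (1 - q ^ (n + k)) * r n k))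
  let U : ℕ → ℕ → ℂ := fun n k => -(s n k *
    (q ^ k * (a * x * (1 - b)) * (1 - q ^ n) * (1 - c * q ^ n) / (1 - q ^ (n + k))))
  have hsplit := sum_antidiagonal_succ_split U V N (by simp [U]) (by simp [V])
  have hN : ∀ p ∈ antidiagonal N, U (p.1 + 1) p.2 + V p.1 (p.2 + 1) =
      s p.1 p.2 * ((1 - a * x) * (a * b * c * x ^ 2 / q) * (1 - a * q ^ (N + 1))
        * (1 - b * q ^ (N + 1)) - (1 - a * b * x) * (a * x) * (1 - b * q ^ (N + 1))
        * (1 - a * c * x * q ^ p.1) * q ^ p.2) := by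
    rintro ⟨n, k⟩ hp
    obtain rfl : n + k = N := by simpa using hp
    have h1 := pow_succ_ne_one hq n
    have h2 := pow_succ_ne_one hq k
    have h3 := pow_succ_ne_one hq (n + k)
    have h4 : 1 - c * q ^ (n + 1) ≠ 0 := sub_ne_zero.2 (mul_pow_ne_one hc hq _).symm
    have cancelU : ∀ A w x y z : ℂ, x ≠ 0 → y ≠ 0 → z ≠ 0 →
        A / x * (y / z) * (w * z * x / y) = A * w := by
      intros; field_simp
    have cancelV : ∀ A w x y : ℂ, x ≠ 0 → y ≠ 0 → y / x * w * A * (x / y) = w * A := by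
      intros; field_simp
    have e1 : n + 1 + k = n + k + 1 := by ring
    have e2 : n + (k + 1) = n + k + 1 := by ring
    have hU : U (n + 1) k = -(s n k * ((1 - a * c * x * q ^ n) * (1 - b * c * x * q ^ n)
        * (q ^ k * (a * x * (1 - b))))) := by
      simp only [U, hs, newtonSummand_succ_left hq hc, e1]
      rw [mul_assoc, cancelU _ _ _ _ _ h4 h3 h1]
    have hV : V n (k + 1) = -(s n k * ((c * x - q ^ (k + 1)) * (a * b * x / q)
        * r n (k + 1))) := by
      simp only [V, hs, newtonSummand_succ_right hq, e2]
      linear_combination -(s n k * r n (k + 1)) *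
        cancelV (a * b * x / q) (c * x - q ^ (k + 1)) _ _ h2 h3
    rw [hU, hV]
    have f3 : q ^ (n + k + 1) = q ^ n * q ^ k * q := by rw [pow_succ, pow_add]
    simp only [r, e2, f3, pow_succ q k]
    field_simp
    ring
  have hN1 : ∑ p ∈ antidiagonal (N + 1), (U p.1 p.2 + V p.1 p.2) =
      ∑ p ∈ antidiagonal (N + 1), ((1 - a * x) * (1 - a * b * c * x * q ^ (N + 1)) * s p.1 p.2
        - (1 - a * b * x) * ((1 - a * c * x) * newtonSummand q (a * q) b c x p.1 p.2)) := by
    refine Finset.sum_congr rfl fun p hp => ?_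
    have hp : p.1 + p.2 = N + 1 := by simpa using hp
    have h3 := pow_succ_ne_one hq N
    have hpow : q ^ (N + 1) = q ^ p.1 * q ^ p.2 := by rw [← hp, pow_add]
    rw [newtonSummand_shift, ← hs]
    simp only [U, V, r, hp]
    rw [hpow] at h3 ⊢
    have hinv := inv_mul_cancel₀ h3
    simp only [div_eq_mul_inv]
    generalize (1 - q ^ p.1 * q ^ p.2)⁻¹ = I at *
    linear_combination (s p.1 p.2 * ((1 - a * x) * (1 - a * b * c * x * (q ^ p.1 * q ^ p.2))
      - (1 - a * b * x) * (1 - a * c * x * q ^ p.1) * q ^ p.2)) * hinv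
  have hN2 : ∑ p ∈ antidiagonal N, (U (p.1 + 1) p.2 + V p.1 (p.2 + 1)) =
      ∑ p ∈ antidiagonal N, ((1 - a * x) * (a * b * c * x ^ 2 / q) * (1 - a * q ^ (N + 1))
        * (1 - b * q ^ (N + 1)) * s p.1 p.2 - (1 - a * b * x) * (a * x) * (1 - b * q ^ (N + 1))
        * ((1 - a * c * x) * newtonSummand q (a * q) b c x p.1 p.2)) := by
    refine Finset.sum_congr rfl fun p hp => ?_
    rw [hN p hp, newtonSummand_shift, ← hs]
    ring
  rw [hN1, hN2] at hsplit
  simp only [Finset.sum_sub_distrib, ← Finset.mul_sum] at hsplit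
  simp only [newtonCoeff, ← hs]
  linear_combination hsplit

/-! ### Contiguous relation for the Newton expansion -/

/-- The terms of the expansion of `ρ` in the Newton basis `homPoch D (q / x) q`. -/
noncomputable def newtonTerm (q a b c D x : ℂ) (N : ℕ) : ℂ :=
  homPoch D (q / x) q N / (qPoch a q (N + 1) * qPoch b q (N + 1)) * newtonCoeff q a b c x N

theorem newtonTerm_swap (q a b c D x : ℂ) :
    newtonTerm q a b c D x = newtonTerm q b a c D x := by
  funext N
  rw [newtonTerm, newtonTerm, newtonCoeff_swap, mul_comm (qPoch a q (N + 1))]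

theorem tsum_sub_eq_of_telescope {α β : ℂ} {s t V : ℕ → ℂ} (hs : Summable s) (ht : Summable t)
    (hV : Tendsto V atTop (𝓝 0)) (h : ∀ N, α * s N - β * t N = V N - V (N + 1)) :
    α * ∑' N, s N - β * ∑' N, t N = V 0 := by
  have h1 := ((hs.hasSum.mul_left α).sub (ht.hasSum.mul_left β)).tendsto_sum_nat
  simp only [h, Finset.sum_range_sub'] at h1
  refine tendsto_nhds_unique h1 ?_
  simpa using tendsto_const_nhds.sub hV

theorem tendsto_const_sub_mul_pow {q : ℂ} (hq : ‖q‖ < 1) (y : ℂ) :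
    Tendsto (fun N : ℕ => 1 - y * q ^ N) atTop (𝓝 1) := by
  simpa using tendsto_const_nhds.sub ((tendsto_pow_atTop_nhds_zero_of_norm_lt_one hq).const_mul y)

theorem newtonTerm_recurrence {q a b c x : ℂ} (hq0 : q ≠ 0) (hq : ‖q‖ < 1) (ha : ‖a‖ < 1)
    (hb : ‖b‖ < 1) (hc : ‖c‖ < 1) (hx : x ≠ 0) (D : ℂ)
    (hs : Summable (newtonTerm q a b c D x)) (hs' : Summable (newtonTerm q (a * q) b c D x)) :
    (1 - a * x) * (1 - a) * (1 - a * b * c * D * x ^ 2 / q) * ∑' N, newtonTerm q a b c D x N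
      - (1 - a * b * x) * (1 - a * c * x) * (1 - a * D * x)
        * ∑' N, newtonTerm q (a * q) b c D x N = -(a * x) := by
  -- In `V (N + 1)` the factor `1 - a q^{N+2}` cancels the last factor of `(aq; q)_{N+2}`, so both
  -- parts share a denominator and the left side of `newtonCoeff_recurrence` appears, up to its
  -- `N`-th coefficients.
  let V : ℕ → ℂ := fun N =>
    (1 - a * x) * (1 - a) * ((1 - a * b * c * x * q ^ N) * newtonTerm q a b c D x N)
      - (1 - a * b * x) * (1 - a * c * x) *
        ((1 - a * q * q ^ N) * newtonTerm q (a * q) b c D x N)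
  have hV : Tendsto V atTop (𝓝 0) := by
    have h1 := (tendsto_const_sub_mul_pow hq (a * b * c * x)).mul hs.tendsto_atTop_zero
    have h2 := (tendsto_const_sub_mul_pow hq (a * q)).mul hs'.tendsto_atTop_zero
    simpa using (h1.const_mul ((1 - a * x) * (1 - a))).sub
      (h2.const_mul ((1 - a * b * x) * (1 - a * c * x)))
  have ha1 : ∀ N : ℕ, 1 - a * q ^ N ≠ 0 := fun N => sub_ne_zero.2 (mul_pow_ne_one ha hq N).symm
  have hb1 : ∀ N : ℕ, 1 - b * q ^ N ≠ 0 := fun N => sub_ne_zero.2 (mul_pow_ne_one hb hq N).symm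
  have haq : ‖a * q‖ < 1 := by
    rw [norm_mul]; exact mul_lt_one_of_nonneg_of_lt_one_left (norm_nonneg _) ha hq.le
  have ha0 := ha1 0
  have hb0 := hb1 0
  have hc0 : 1 - c ≠ 0 := by simpa using sub_ne_zero.2 (mul_pow_ne_one hc hq 0).symm
  rw [pow_zero, mul_one] at ha0 hb0
  have hV0 : V 0 = -(a * x) := by
    have ha2 := ha1 1
    rw [pow_one] at ha2
    simp only [V, newtonTerm, newtonCoeff_zero, homPoch_zero, qPoch_succ, qPoch_zero, pow_zero,
      mul_one, one_mul]
    field_simp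
    ring
  rw [← hV0]
  refine tsum_sub_eq_of_telescope hs hs' hV fun N => ?_
  have hrec := newtonCoeff_recurrence hq0 hq hc a b x N
  have hE := qPoch_ne_zero (mul_pow_ne_one haq hq) N
  have hB := qPoch_ne_zero (mul_pow_ne_one hb hq) (N + 1)
  have ha2 := ha1 (N + 1)
  have ha3 := ha1 (N + 2)
  have hb2 := hb1 (N + 1)
  have e1 : a * q * q ^ N = a * q ^ (N + 1) := by ring
  have e2 : a * q * q ^ (N + 1) = a * q ^ (N + 2) := by ring
  simp only [V, newtonTerm, qPoch_succ' a, qPoch_succ (a * q), qPoch_succ b q (N + 1),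
    homPoch_succ, e1, e2]
  generalize qPoch (a * q) q N = E at *
  generalize qPoch b q (N + 1) = B at *
  generalize homPoch D (q / x) q N = P at *
  generalize newtonCoeff q a b c x (N + 1) = c1 at *
  generalize newtonCoeff q a b c x N = c0 at *
  generalize newtonCoeff q (a * q) b c x (N + 1) = d1 at *
  generalize newtonCoeff q (a * q) b c x N = d0 at *
  -- The coefficient recurrence is written in `q^{N+1}`, so this becomes the only power besides the
  -- one inside `1 - a q^{N+2}`, which cancels.
  have e3 : q ^ N = q ^ (N + 1) / q := by rw [pow_succ]; field_simp
  rw [e3]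
  generalize q ^ (N + 1) = M at *
  generalize 1 - a * q ^ (N + 2) = A2 at *
  generalize hA1 : 1 - a * M = A1 at *
  generalize hB1 : 1 - b * M = B1 at *
  generalize hA0 : 1 - a = A0 at *
  have key : (1 - a * x) * A0 * ((1 - a * b * c * x * M) *
        (P * (D - q / x * (M / q)) / (A0 * (E * A1) * (B * B1)) * c1)) -
      (1 - a * b * x) * (1 - a * c * x) *
        (A2 * (P * (D - q / x * (M / q)) / (E * A1 * A2 * (B * B1)) * d1)) =
      P * (D - M / x) / (E * B) * ((1 - a * x) * (a * b * c * x ^ 2 / q) * c0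
        - (1 - a * b * x) * (1 - a * c * x) * (a * x) * d0 / A1) := by
    have hrec' : (1 - a * x) * (1 - a * b * c * x * M) * c1
        - (1 - a * b * x) * (1 - a * c * x) * d1 =
        A1 * B1 * ((1 - a * x) * (a * b * c * x ^ 2 / q) * c0
        - (1 - a * b * x) * (1 - a * c * x) * (a * x) * d0 / A1) := by
      field_simp
      field_simp at hrec
      linear_combination hrec
    have h1 : (1 - a * x) * A0 * ((1 - a * b * c * x * M) *
          (P * (D - q / x * (M / q)) / (A0 * (E * A1) * (B * B1)) * c1)) -
        (1 - a * b * x) * (1 - a * c * x) *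
          (A2 * (P * (D - q / x * (M / q)) / (E * A1 * A2 * (B * B1)) * d1)) =
        P * (D - M / x) / (E * B) / (A1 * B1) * ((1 - a * x) * (1 - a * b * c * x * M) * c1
        - (1 - a * b * x) * (1 - a * c * x) * d1) := by
      field_simp
    rw [h1, hrec']
    field_simp
  rw [key]
  field_simp
  rw [← hA1]
  ring

/-! ### Majorants and absolute convergence -/

theorem prod_one_add_mul_pow_le {t r : ℝ} (ht : 0 ≤ t) (hr0 : 0 ≤ r) (hr : r < 1) (n : ℕ) :
    ∏ k ∈ range n, (1 + t * r ^ k) ≤ Real.exp (t / (1 - r)) := by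
  calc ∏ k ∈ range n, (1 + t * r ^ k) ≤ ∏ k ∈ range n, Real.exp (t * r ^ k) :=
        Finset.prod_le_prod (fun k _ => by positivity)
          fun k _ => by linarith [Real.add_one_le_exp (t * r ^ k)]
    _ = Real.exp (t * ∑ k ∈ range n, r ^ k) := by rw [← Real.exp_sum, Finset.mul_sum]
    _ ≤ Real.exp (t / (1 - r)) := by
        rw [div_eq_mul_inv, ← tsum_geometric_of_lt_one hr0 hr]
        gcongr
        exact (summable_geometric_of_lt_one hr0 hr).sum_le_tsum _ fun _ _ => by positivity

theorem norm_qPoch_le {a q : ℂ} {t : ℝ} (hq : ‖q‖ < 1) (ha : ‖a‖ ≤ t) (n : ℕ) :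
    ‖qPoch a q n‖ ≤ Real.exp (t / (1 - ‖q‖)) := by
  refine le_trans ?_
    (prod_one_add_mul_pow_le ((norm_nonneg a).trans ha) (norm_nonneg q) hq n)
  rw [qPoch, norm_prod]
  refine Finset.prod_le_prod (fun _ _ => norm_nonneg _) fun k _ => (norm_sub_le _ _).trans ?_
  rw [norm_one, norm_mul, norm_pow]
  gcongr

theorem norm_homPoch_le {x q : ℂ} {s : ℝ} (hs : 0 < s) (hq : ‖q‖ < 1) (hx : ‖x‖ ≤ s) (y : ℂ)
    (n : ℕ) : ‖homPoch x y q n‖ ≤ s ^ n * Real.exp (‖y‖ / s / (1 - ‖q‖)) := by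
  refine le_trans ?_ (mul_le_mul_of_nonneg_left
    (prod_one_add_mul_pow_le (by positivity) (norm_nonneg q) hq n) (by positivity))
  have h : s ^ n = ∏ _k ∈ range n, s := by simp
  rw [homPoch, norm_prod, h, ← Finset.prod_mul_distrib]
  refine Finset.prod_le_prod (fun _ _ => norm_nonneg _) fun k _ => (norm_sub_le _ _).trans ?_
  have h2 : s * (1 + ‖y‖ / s * ‖q‖ ^ k) = s + ‖y‖ * ‖q‖ ^ k := by field_simp
  rw [norm_mul, norm_pow, h2]
  gcongr

/-- Each reciprocal factor is controlled by `1/(1 - s) ≤ 1 + s/(1 - t)` for `0 ≤ s ≤ t < 1`, with `s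
= t‖q‖^k`; the product of these bounds is again a convergent one. -/
theorem norm_qPoch_inv_le {a q : ℂ} {t : ℝ} (ht : t < 1) (hq : ‖q‖ < 1) (ha : ‖a‖ ≤ t) (n : ℕ) :
    ‖(qPoch a q n)⁻¹‖ ≤ Real.exp (t / (1 - t) / (1 - ‖q‖)) := by
  have ht0 : 0 ≤ t := (norm_nonneg a).trans ha
  have ht1 : 0 < 1 - t := by linarith
  refine le_trans ?_ (prod_one_add_mul_pow_le (by positivity) (norm_nonneg q) hq n)
  rw [qPoch, norm_inv, norm_prod, ← Finset.prod_inv_distrib]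
  refine Finset.prod_le_prod (fun _ _ => by positivity) fun k _ => ?_
  set s := t * ‖q‖ ^ k with hs
  have hs0 : 0 ≤ s := by positivity
  have hst : s ≤ t := mul_le_of_le_one_right ht0 (pow_le_one₀ (norm_nonneg _) hq.le)
  have h1 : 1 - s ≤ ‖1 - a * q ^ k‖ := by
    have h2 : ‖a * q ^ k‖ ≤ s := by
      rw [norm_mul, norm_pow, hs]
      gcongr
    have h3 := norm_sub_norm_le 1 (a * q ^ k)
    rw [norm_one] at h3
    linarith
  have h4 : t / (1 - t) * ‖q‖ ^ k = s / (1 - t) := by rw [hs]; ring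
  rw [h4]
  have h5 : 0 < 1 - s := by linarith
  refine (inv_anti₀ h5 h1).trans ?_
  rw [inv_le_iff_one_le_mul₀ h5]
  have h6 : (1 + s / (1 - t)) * (1 - s) = 1 + s * (t - s) / (1 - t) := by
    field_simp
    ring
  rw [h6]
  have : 0 ≤ s * (t - s) / (1 - t) :=
    div_nonneg (mul_nonneg hs0 (by linarith)) ht1.le
  linarith

theorem norm_gaussBinom_le {q : ℂ} (hq : ‖q‖ < 1) (n k : ℕ) :
    ‖gaussBinom q n k‖ ≤
      Real.exp (1 / (1 - ‖q‖)) * Real.exp (‖q‖ / (1 - ‖q‖) / (1 - ‖q‖)) := by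
  rw [gaussBinom, div_eq_mul_inv, norm_mul]
  refine mul_le_mul (norm_qPoch_le hq ?_ k) (norm_qPoch_inv_le hq hq le_rfl k)
    (norm_nonneg _) (Real.exp_pos _).le
  rw [norm_pow]
  exact pow_le_one₀ (norm_nonneg _) hq.le

/-- The terms of the double series `ρ`. -/
noncomputable def pairTerm (q a b c D x : ℂ) (p : ℕ × ℕ) : ℂ :=
  homPoch D (q / x) q (p.1 + p.2) / (qPoch a q (p.1 + p.2 + 1) * qPoch b q (p.1 + p.2 + 1))
    * newtonSummand q a b c x p.1 p.2

theorem sum_antidiagonal_pairTerm (q a b c D x : ℂ) (N : ℕ) :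
    ∑ p ∈ antidiagonal N, pairTerm q a b c D x p = newtonTerm q a b c D x N := by
  rw [newtonTerm, newtonCoeff, Finset.mul_sum]
  refine Finset.sum_congr rfl fun p hp => ?_
  have hp : p.1 + p.2 = N := by simpa using hp
  rw [pairTerm, hp]

/-- Room above `‖D‖` and `‖c x‖` that keeps the product with `‖a b x / q‖` below `1`. -/
theorem exists_radii {q a b c D x : ℂ} (hD : ‖D‖ < 1) (h : ‖a * b * c * D * x ^ 2 / q‖ < 1) :
    ∃ s t : ℝ, 0 < s ∧ s < 1 ∧ 0 < t ∧ ‖D‖ ≤ s ∧ ‖c * x‖ ≤ t ∧ s * t * ‖a * b * x / q‖ < 1 := by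
  -- The strict inequalities survive a small increase `e > 0`. Positivity of `e` matters because `D`
  -- or `c` may be `0`, while `s` and `t` appear as denominators in the bounds.
  have h1 : Tendsto (fun e : ℝ => (‖D‖ + e) * (‖c * x‖ + e) * ‖a * b * x / q‖) (𝓝[>] 0)
      (𝓝 ((‖D‖ + 0) * (‖c * x‖ + 0) * ‖a * b * x / q‖)) :=
    (Continuous.tendsto (by fun_prop) 0).mono_left nhdsWithin_le_nhds
  have h2 : Tendsto (fun e : ℝ => ‖D‖ + e) (𝓝[>] 0) (𝓝 (‖D‖ + 0)) :=
    (Continuous.tendsto (by fun_prop) 0).mono_left nhdsWithin_le_nhds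
  have h3 : (‖D‖ + 0) * (‖c * x‖ + 0) * ‖a * b * x / q‖ < 1 := by
    rw [add_zero, add_zero, ← norm_mul, ← norm_mul]
    refine lt_of_eq_of_lt ?_ h
    congr 1
    ring
  obtain ⟨e, he1, he2, he3⟩ := ((h1.eventually_lt_const h3).and
    ((h2.eventually_lt_const (by simpa using hD)).and self_mem_nhdsWithin)).exists
  have he3 : 0 < e := he3
  exact ⟨‖D‖ + e, ‖c * x‖ + e, by positivity, he2, by positivity, by linarith, by linarith, he1⟩

/-- A common summable majorant of the double series for all smaller parameters. -/
theorem exists_summable_pairTerm_bound {q a b c D x : ℂ} (hq : ‖q‖ < 1) (ha : ‖a‖ < 1)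
    (hb : ‖b‖ < 1) (hc : ‖c‖ < 1) (hD : ‖D‖ < 1) (h : ‖a * b * c * D * x ^ 2 / q‖ < 1) :
    ∃ g : ℕ × ℕ → ℝ, Summable g ∧ ∀ a' b' c' D' : ℂ, ‖a'‖ ≤ ‖a‖ → ‖b'‖ ≤ ‖b‖ → ‖c'‖ ≤ ‖c‖ →
      ‖D'‖ ≤ ‖D‖ → ∀ p, ‖pairTerm q a' b' c' D' x p‖ ≤ g p := by
  obtain ⟨s, t, hs0, hs1, ht0, hDs, hct, hst⟩ := exists_radii hD h
  set y := s * t * ‖a * b * x / q‖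
  have hy0 : 0 ≤ y := by positivity
  have hsum : Summable fun p : ℕ × ℕ => s ^ p.1 * y ^ p.2 :=
    (summable_geometric_of_lt_one hs0.le hs1).mul_of_nonneg
      (summable_geometric_of_lt_one hy0 hst) (fun _ => by positivity) (fun _ => by positivity)
  let inv : ℝ → ℝ := fun t => Real.exp (t / (1 - t) / (1 - ‖q‖))
  let K : ℝ := Real.exp (‖q / x‖ / s / (1 - ‖q‖)) * (inv ‖a‖ * inv ‖b‖) *
    (Real.exp (‖a‖ * ‖c‖ * ‖x‖ / (1 - ‖q‖)) * Real.exp (‖b‖ * ‖c‖ * ‖x‖ / (1 - ‖q‖)) * inv ‖c‖ *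
      (Real.exp (1 / (1 - ‖q‖)) * inv ‖q‖) * Real.exp (‖q‖ / t / (1 - ‖q‖)))
  refine ⟨fun p => K * (s ^ p.1 * y ^ p.2), hsum.mul_left K, ?_⟩
  rintro a' b' c' D' ha' hb' hc' hD' ⟨n, k⟩
  have e1 := norm_homPoch_le hs0 hq (hD'.trans hDs) (q / x) (n + k)
  have e2 := norm_qPoch_inv_le ha hq ha' (n + k + 1)
  have e3 := norm_qPoch_inv_le hb hq hb' (n + k + 1)
  have e4 : ‖qPoch (a' * c' * x) q n‖ ≤ Real.exp (‖a‖ * ‖c‖ * ‖x‖ / (1 - ‖q‖)) := by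
    refine norm_qPoch_le hq ?_ n
    rw [norm_mul, norm_mul]
    gcongr
  have e5 : ‖qPoch (b' * c' * x) q n‖ ≤ Real.exp (‖b‖ * ‖c‖ * ‖x‖ / (1 - ‖q‖)) := by
    refine norm_qPoch_le hq ?_ n
    rw [norm_mul, norm_mul]
    gcongr
  have e6 := norm_qPoch_inv_le hc hq hc' (n + 1)
  have e7 := norm_gaussBinom_le hq n k
  have hcx : ‖c' * x‖ ≤ t := by
    refine le_trans ?_ hct
    rw [norm_mul, norm_mul]
    gcongr
  have e8 := norm_homPoch_le ht0 hq hcx q k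
  have e9 : ‖(a' * b' * x / q) ^ k‖ ≤ ‖a * b * x / q‖ ^ k := by
    rw [norm_pow]
    simp only [norm_mul, norm_div]
    gcongr
  -- The bounds supply `s^(n+k)` and `t^k`; regrouped, they form a product of two independent
  -- geometric series with ratios `s` and `y`.
  have hy : s ^ n * y ^ k = s ^ (n + k) * (t ^ k * ‖a * b * x / q‖ ^ k) := by
    rw [mul_pow, mul_pow]; ring
  simp only [pairTerm, newtonSummand, div_eq_mul_inv, mul_inv, norm_mul] at *
  calc _ ≤ s ^ (n + k) * Real.exp (‖q‖ * ‖x⁻¹‖ * s⁻¹ * (1 - ‖q‖)⁻¹) * (inv ‖a‖ * inv ‖b‖) *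
        (Real.exp (‖a‖ * ‖c‖ * ‖x‖ * (1 - ‖q‖)⁻¹) * Real.exp (‖b‖ * ‖c‖ * ‖x‖ * (1 - ‖q‖)⁻¹)
          * inv ‖c‖ * (Real.exp (1 * (1 - ‖q‖)⁻¹) * inv ‖q‖)
          * (t ^ k * Real.exp (‖q‖ * t⁻¹ * (1 - ‖q‖)⁻¹))
          * (‖a‖ * ‖b‖ * ‖x‖ * ‖q⁻¹‖) ^ k) := by
        simp only [inv, div_eq_mul_inv]
        gcongr
    _ = _ := by
        rw [hy]
        simp only [K, div_eq_mul_inv, norm_mul]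
        ring

/-- A common summable majorant of the Newton expansion for all smaller parameters. -/
theorem exists_summable_newtonTerm_bound {q a b c D x : ℂ} (hq : ‖q‖ < 1) (ha : ‖a‖ < 1)
    (hb : ‖b‖ < 1) (hc : ‖c‖ < 1) (hD : ‖D‖ < 1) (h : ‖a * b * c * D * x ^ 2 / q‖ < 1) :
    ∃ g : ℕ → ℝ, Summable g ∧ ∀ a' b' c' D' : ℂ, ‖a'‖ ≤ ‖a‖ → ‖b'‖ ≤ ‖b‖ → ‖c'‖ ≤ ‖c‖ →
      ‖D'‖ ≤ ‖D‖ → ∀ N, ‖newtonTerm q a' b' c' D' x N‖ ≤ g N := by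
  obtain ⟨g, hg, hle⟩ := exists_summable_pairTerm_bound hq ha hb hc hD h
  refine ⟨fun N => ∑ p ∈ antidiagonal N, g p, ?_, fun a' b' c' D' ha' hb' hc' hD' N => ?_⟩
  · have := (Finset.HasAntidiagonal.sigmaAntidiagonalEquivProd (A := ℕ)).summable_iff.2 hg
    refine this.sigma.congr fun N => ?_
    rw [tsum_fintype]
    exact Finset.sum_coe_sort (antidiagonal N) g
  · rw [← sum_antidiagonal_pairTerm]
    exact norm_sum_le_of_le _ fun p _ => hle a' b' c' D' ha' hb' hc' hD' p

theorem summable_pairTerm {q a b c D x : ℂ} (hq : ‖q‖ < 1) (ha : ‖a‖ < 1)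
    (hb : ‖b‖ < 1) (hc : ‖c‖ < 1) (hD : ‖D‖ < 1) (h : ‖a * b * c * D * x ^ 2 / q‖ < 1) :
    Summable (pairTerm q a b c D x) := by
  obtain ⟨g, hg, hle⟩ := exists_summable_pairTerm_bound hq ha hb hc hD h
  exact .of_norm_bounded hg fun p => hle a b c D le_rfl le_rfl le_rfl le_rfl p

theorem tsum_pairTerm {q a b c D x : ℂ} (h : Summable (pairTerm q a b c D x)) :
    ∑' n, ∑' k, pairTerm q a b c D x (n, k) = ∑' N, newtonTerm q a b c D x N := by
  rw [← h.tsum_prod, ← Finset.HasAntidiagonal.sigmaAntidiagonalEquivProd.tsum_eq]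
  have := (Finset.HasAntidiagonal.sigmaAntidiagonalEquivProd (A := ℕ)).summable_iff.2 h
  rw [Summable.tsum_sigma (by exact this)]
  refine tsum_congr fun N => ?_
  rw [tsum_fintype, ← sum_antidiagonal_pairTerm]
  exact Finset.sum_coe_sort (antidiagonal N) (pairTerm q a b c D x)

/-! ### The degenerate cases `a = b = 0` and `a = b = c = 0` -/

/-- The factor `(abx/q)^k` leaves only `k = 0` on each antidiagonal. -/
theorem newtonTerm_zero_zero (q c D x : ℂ) (N : ℕ) :
    newtonTerm q 0 0 c D x N = homPoch D (q / x) q N / qPoch c q (N + 1) := by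
  have h : newtonCoeff q 0 0 c x N = 1 / qPoch c q (N + 1) := by
    rw [newtonCoeff, Finset.sum_eq_single (N, 0)]
    · simp [newtonSummand, qPoch_zero_left, gaussBinom_zero_right, homPoch_zero]
    · rintro ⟨n, k⟩ hp hne
      have hk : k ≠ 0 := by
        rintro rfl
        exact hne (by simpa using hp)
      simp [newtonSummand, hk]
    · simp
  rw [newtonTerm, h, qPoch_zero_left]
  ring

theorem newtonTerm_zero_zero_recurrence {q c x : ℂ} (hq : ‖q‖ < 1) (hc : ‖c‖ < 1) (hx : x ≠ 0)
    (D : ℂ) (hs : Summable (newtonTerm q 0 0 c D x))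
    (hs' : Summable (newtonTerm q 0 0 (c * q) D x)) :
    (1 - c * x) * (1 - c) * ∑' N, newtonTerm q 0 0 c D x N
      - (1 - c * D * x) * ∑' N, newtonTerm q 0 0 (c * q) D x N = -(c * x) := by
  let V : ℕ → ℂ := fun N => -(c * x) * (1 - c) * newtonTerm q 0 0 c D x N
  have hV : Tendsto V atTop (𝓝 0) := by
    simpa [V] using hs.tendsto_atTop_zero.const_mul (-(c * x) * (1 - c))
  have hc1 : ∀ N : ℕ, 1 - c * q ^ N ≠ 0 := fun N => sub_ne_zero.2 (mul_pow_ne_one hc hq N).symm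
  have hc0 := hc1 0
  rw [pow_zero, mul_one] at hc0
  have hV0 : V 0 = -(c * x) := by
    simp only [V, newtonTerm_zero_zero, homPoch_zero, qPoch_succ, qPoch_zero, pow_zero, mul_one,
      one_mul]
    field_simp
  rw [← hV0]
  refine tsum_sub_eq_of_telescope hs hs' hV fun N => ?_
  have hE : qPoch (c * q) q N ≠ 0 := by
    have := qPoch_ne_zero (mul_pow_ne_one hc hq) (N + 1)
    rw [qPoch_succ'] at this
    exact right_ne_zero_of_mul this
  have h1 : 1 - c * q * q ^ N ≠ 0 := by
    have := hc1 (N + 1)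
    rwa [pow_succ', ← mul_assoc] at this
  simp only [V, newtonTerm_zero_zero, qPoch_succ' c, qPoch_succ (c * q), homPoch_succ]
  generalize qPoch (c * q) q N = E at *
  generalize homPoch D (q / x) q N = P at *
  generalize q ^ N = M at *
  generalize hA : 1 - c = A at *
  generalize hB : 1 - c * q * M = B at *
  have key : (1 - c * x) * A * (P / (A * E)) - (1 - c * D * x) * (P / (E * B)) =
      P / (E * B) * ((1 - c * x) * B - (1 - c * D * x)) := by field_simp
  have key2 : -(c * x) * A * (P / (A * E)) - -(c * x) * A * (P * (D - q / x * M) / (A * (E * B))) =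
      P / (E * B) * (-(c * x) * B + (c * x) * (D - q / x * M)) := by field_simp; ring
  have key3 : x * (q / x) = q := by field_simp
  rw [key, key2, ← hB]
  linear_combination P / (E * (1 - c * q * M)) * c * M * key3

theorem newtonTerm_zero_zero_zero (q D x : ℂ) (N : ℕ) :
    newtonTerm q 0 0 0 D x N = homPoch D (q / x) q N := by
  rw [newtonTerm_zero_zero, qPoch_zero_left, div_one]

theorem newtonTerm_zero_zero_zero_recurrence {q x : ℂ} (hx : x ≠ 0) (D : ℂ)
    (hs : Summable (newtonTerm q 0 0 0 D x)) (hs' : Summable (newtonTerm q 0 0 0 (D * q) x)) :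
    (1 - D * x) * (1 - D) * ∑' N, newtonTerm q 0 0 0 D x N
      - 1 * ∑' N, newtonTerm q 0 0 0 (D * q) x N = -(D * x) := by
  let V : ℕ → ℂ := fun N => (1 - D * x) * newtonTerm q 0 0 0 D x N
    - newtonTerm q 0 0 0 (D * q) x N
  have hV : Tendsto V atTop (𝓝 0) := by
    simpa using (hs.tendsto_atTop_zero.const_mul (1 - D * x)).sub hs'.tendsto_atTop_zero
  have hV0 : V 0 = -(D * x) := by
    simp [V, newtonTerm_zero_zero_zero, homPoch_zero]
  rw [← hV0]
  refine tsum_sub_eq_of_telescope hs hs' hV fun N => ?_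
  -- Taking `q` out of every factor moves the nodes from `q^{j+1}/x` to `q^j/x`; all but the first
  -- are nodes of the unshifted product.
  have h : homPoch (D * q) (q / x) q (N + 1) =
      q ^ (N + 1) * (D - 1 / x) * homPoch D (q / x) q N := by
    have e1 : D * q = q * D := mul_comm ..
    have e2 : q / x = q * (1 / x) := by ring
    rw [e1, e2, homPoch_mul_left, add_comm N 1, homPoch_add]
    simp [homPoch_succ, homPoch_zero, mul_comm, mul_assoc]
  simp only [V, newtonTerm_zero_zero_zero, h]
  rw [homPoch_succ]
  have key : x * x⁻¹ = 1 := mul_inv_cancel₀ hx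
  simp only [div_eq_mul_inv, pow_succ]
  linear_combination (homPoch D (q * x⁻¹) q N * q * q ^ N * D) * key

/-! ### Infinite products and limits of recurrences -/

theorem tendsto_qPoch_qPochInf (a : ℂ) {q : ℂ} (hq : ‖q‖ < 1) :
    Tendsto (fun n => qPoch a q n) atTop (𝓝 (qPochInf a q)) :=
  (multipliable_qPochInf a hq).hasProd.tendsto_prod_nat

/-- The reciprocals of the partial products are bounded uniformly, so these products stay away from
`0`. -/
theorem qPochInf_ne_zero {a q : ℂ} (hq : ‖q‖ < 1) (ha : ‖a‖ < 1) : qPochInf a q ≠ 0 := by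
  intro h0
  have h := (tendsto_qPoch_qPochInf a hq).norm.mul_const
    (Real.exp (‖a‖ / (1 - ‖a‖) / (1 - ‖q‖)))
  rw [h0, norm_zero, zero_mul] at h
  refine absurd (ge_of_tendsto' (b := 1) h fun n => ?_) (by norm_num)
  have h1 := norm_qPoch_inv_le ha hq le_rfl n
  have h2 : 0 < ‖qPoch a q n‖ := norm_pos_iff.2 (qPoch_ne_zero (mul_pow_ne_one ha hq) n)
  rw [norm_inv, inv_le_iff_one_le_mul₀ h2] at h1
  linarith

/-- The cross-multiplied form of iterating a first-order recurrence to its limit: no factor has to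
be nonzero. -/
theorem mul_eq_mul_of_recurrence {F f g : ℕ → ℂ} {A B L : ℂ}
    (h : ∀ M, f M * F M = g M * F (M + 1))
    (hf : Tendsto (fun M => ∏ i ∈ range M, f i) atTop (𝓝 A))
    (hg : Tendsto (fun M => ∏ i ∈ range M, g i) atTop (𝓝 B))
    (hF : Tendsto F atTop (𝓝 L)) : A * F 0 = B * L := by
  have hM : ∀ M, (∏ i ∈ range M, f i) * F 0 = (∏ i ∈ range M, g i) * F M := by
    intro M
    induction M with
    | zero => simp
    | succ M ih =>
      rw [Finset.prod_range_succ, Finset.prod_range_succ]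
      linear_combination f M * ih + (∏ i ∈ range M, g i) * h M
  refine tendsto_nhds_unique (hf.mul_const (F 0)) ?_
  simpa only [hM] using hg.mul hF

theorem tendsto_qPoch {ι : Type*} {l : Filter ι} {f : ι → ℂ} {y : ℂ} (h : Tendsto f l (𝓝 y))
    (q : ℂ) (n : ℕ) : Tendsto (fun i => qPoch (f i) q n) l (𝓝 (qPoch y q n)) :=
  tendsto_finsetProd _ fun k _ => (h.mul_const (q ^ k)).const_sub 1

theorem tendsto_homPoch {ι : Type*} {l : Filter ι} {f : ι → ℂ} {x : ℂ} (h : Tendsto f l (𝓝 x))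
    (y q : ℂ) (n : ℕ) : Tendsto (fun i => homPoch (f i) y q n) l (𝓝 (homPoch x y q n)) :=
  tendsto_finsetProd _ fun k _ => h.sub_const (y * q ^ k)

/-- Dominated convergence for the Newton expansion when the parameters shrink. -/
theorem tendsto_tsum_newtonTerm {q a b c D x a₀ b₀ c₀ D₀ : ℂ} (hq : ‖q‖ < 1) (ha : ‖a‖ < 1)
    (hb : ‖b‖ < 1) (hc : ‖c‖ < 1) (hD : ‖D‖ < 1) (h : ‖a * b * c * D * x ^ 2 / q‖ < 1)
    {A B C E : ℕ → ℂ} (hA : ∀ M, ‖A M‖ ≤ ‖a‖) (hB : ∀ M, ‖B M‖ ≤ ‖b‖) (hC : ∀ M, ‖C M‖ ≤ ‖c‖)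
    (hE : ∀ M, ‖E M‖ ≤ ‖D‖) (hA₀ : Tendsto A atTop (𝓝 a₀)) (hB₀ : Tendsto B atTop (𝓝 b₀))
    (hC₀ : Tendsto C atTop (𝓝 c₀)) (hE₀ : Tendsto E atTop (𝓝 D₀)) :
    Tendsto (fun M => ∑' N, newtonTerm q (A M) (B M) (C M) (E M) x N) atTop
      (𝓝 (∑' N, newtonTerm q a₀ b₀ c₀ D₀ x N)) := by
  obtain ⟨g, hg, hle⟩ := exists_summable_newtonTerm_bound hq ha hb hc hD h
  -- The limit parameters obey the same norm bounds, so no denominator vanishes in the limit.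
  have hne : ∀ {y z : ℂ} {Y : ℕ → ℂ}, ‖y‖ < 1 → (∀ M, ‖Y M‖ ≤ ‖y‖) → Tendsto Y atTop (𝓝 z) →
      ∀ n, qPoch z q n ≠ 0 := fun hy hY hz n =>
    qPoch_ne_zero (mul_pow_ne_one ((le_of_tendsto' hz.norm hY).trans_lt hy) hq) n
  refine tendsto_tsum_of_dominated_convergence hg (fun N => ?_)
    (Eventually.of_forall fun M N => hle _ _ _ _ (hA M) (hB M) (hC M) (hE M) N)
  refine Tendsto.mul ?_ (tendsto_finsetSum _ fun p _ => ?_)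
  · exact (tendsto_homPoch hE₀ _ _ _).div ((tendsto_qPoch hA₀ _ _).mul (tendsto_qPoch hB₀ _ _))
      (mul_ne_zero (hne ha hA hA₀ _) (hne hb hB hB₀ _))
  · exact (((((tendsto_qPoch ((hA₀.mul hC₀).mul_const x) _ _).mul
      (tendsto_qPoch ((hB₀.mul hC₀).mul_const x) _ _)).div (tendsto_qPoch hC₀ _ _)
      (hne hc hC hC₀ _)).mul_const _).mul (tendsto_homPoch (hC₀.mul_const x) _ _ _)).mul
      ((((hA₀.mul hB₀).mul_const x).div_const q).pow _)

/-! ### Antisymmetrization in `u` and `v` -/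

/-- The conditions under which the double series `ρ(a, b, c, d, duv, u, v)` and its mirror image
under `u ↔ v` converge. -/
structure Admissible (q a b c d u v : ℂ) : Prop where
  au : ‖a * u‖ < 1
  av : ‖a * v‖ < 1
  bu : ‖b * u‖ < 1
  bv : ‖b * v‖ < 1
  cu : ‖c * u‖ < 1
  cv : ‖c * v‖ < 1
  du : ‖d * u‖ < 1
  dv : ‖d * v‖ < 1
  abcd : ‖a * b * c * d * u ^ 2 * v ^ 2 / q‖ < 1

namespace Admissible

variable {q a b c d u v : ℂ}

theorem swap (h : Admissible q a b c d u v) : Admissible q a b c d v u :=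
  ⟨h.av, h.au, h.bv, h.bu, h.cv, h.cu, h.dv, h.du, by
    rw [mul_right_comm]; exact h.abcd⟩

theorem mono (h : Admissible q a b c d u v) {a' b' c' d' : ℂ} (ha : ‖a'‖ ≤ ‖a‖) (hb : ‖b'‖ ≤ ‖b‖)
    (hc : ‖c'‖ ≤ ‖c‖) (hd : ‖d'‖ ≤ ‖d‖) : Admissible q a' b' c' d' u v := by
  have key : ∀ {y y' : ℂ} (w : ℂ), ‖y'‖ ≤ ‖y‖ → ‖y * w‖ < 1 → ‖y' * w‖ < 1 := by
    intro y y' w hy hw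
    refine lt_of_le_of_lt ?_ hw
    rw [norm_mul, norm_mul]
    gcongr
  refine ⟨key u ha h.au, key v ha h.av, key u hb h.bu, key v hb h.bv, key u hc h.cu, key v hc h.cv,
    key u hd h.du, key v hd h.dv, lt_of_le_of_lt ?_ h.abcd⟩
  simp only [norm_mul, norm_div]
  gcongr

theorem prod_lt_one (h : Admissible q a b c d u v) (hv : v ≠ 0) :
    ‖a * v * (b * v) * (c * v) * (d * v) * (u / v) ^ 2 / q‖ < 1 := by
  refine lt_of_eq_of_lt ?_ h.abcd
  congr 1
  field_simp

end Admissible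

/-- The antisymmetrized Newton expansion. -/
noncomputable def newtonDiff (q a b c d u v : ℂ) : ℂ :=
  v * ∑' N, newtonTerm q (a * v) (b * v) (c * v) (d * v) (u / v) N
    - u * ∑' N, newtonTerm q (a * u) (b * u) (c * u) (d * u) (v / u) N

/-- The main recurrence moves only the first parameter; this symmetry makes it available for `b`. -/
theorem newtonDiff_swap (q a b c d u v : ℂ) :
    newtonDiff q a b c d u v = newtonDiff q b a c d u v := by
  simp only [newtonDiff, newtonTerm_swap q (a * _)]

theorem summable_newtonTerm {q a b c D x : ℂ} (hq : ‖q‖ < 1) (ha : ‖a‖ < 1)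
    (hb : ‖b‖ < 1) (hc : ‖c‖ < 1) (hD : ‖D‖ < 1) (h : ‖a * b * c * D * x ^ 2 / q‖ < 1) :
    Summable (newtonTerm q a b c D x) := by
  obtain ⟨g, hg, hle⟩ := exists_summable_newtonTerm_bound hq ha hb hc hD h
  exact .of_norm_bounded hg fun p => hle a b c D le_rfl le_rfl le_rfl le_rfl p

theorem Admissible.summable_newtonTerm {q a b c d u v : ℂ} (h : Admissible q a b c d u v)
    (hq : ‖q‖ < 1) (hv : v ≠ 0) :
    Summable (newtonTerm q (a * v) (b * v) (c * v) (d * v) (u / v)) :=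
  _root_.summable_newtonTerm hq h.av h.bv h.cv h.dv (h.prod_lt_one hv)

theorem tendsto_newtonDiff {q a b c d u v a₀ b₀ c₀ d₀ : ℂ} (hq : ‖q‖ < 1) (hu : u ≠ 0)
    (hv : v ≠ 0) (h : Admissible q a b c d u v)
    {A B C E : ℕ → ℂ} (hA : ∀ M, ‖A M‖ ≤ ‖a‖) (hB : ∀ M, ‖B M‖ ≤ ‖b‖) (hC : ∀ M, ‖C M‖ ≤ ‖c‖)
    (hE : ∀ M, ‖E M‖ ≤ ‖d‖) (hA₀ : Tendsto A atTop (𝓝 a₀)) (hB₀ : Tendsto B atTop (𝓝 b₀))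
    (hC₀ : Tendsto C atTop (𝓝 c₀)) (hE₀ : Tendsto E atTop (𝓝 d₀)) :
    Tendsto (fun M => newtonDiff q (A M) (B M) (C M) (E M) u v) atTop
      (𝓝 (newtonDiff q a₀ b₀ c₀ d₀ u v)) := by
  have key : ∀ {y : ℂ} {Y : ℕ → ℂ} (w : ℂ), (∀ M, ‖Y M‖ ≤ ‖y‖) → ∀ M, ‖Y M * w‖ ≤ ‖y * w‖ := by
    intro y Y w hY M
    rw [norm_mul, norm_mul]
    exact mul_le_mul_of_nonneg_right (hY M) (norm_nonneg _)
  refine Tendsto.sub (Tendsto.const_mul _ ?_) (Tendsto.const_mul _ ?_)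
  · exact tendsto_tsum_newtonTerm hq h.av h.bv h.cv h.dv (h.prod_lt_one hv) (key v hA) (key v hB)
      (key v hC) (key v hE) (hA₀.mul_const v) (hB₀.mul_const v) (hC₀.mul_const v) (hE₀.mul_const v)
  · exact tendsto_tsum_newtonTerm hq h.au h.bu h.cu h.du (h.swap.prod_lt_one hu) (key u hA)
      (key u hB) (key u hC) (key u hE) (hA₀.mul_const u) (hB₀.mul_const u) (hC₀.mul_const u)
      (hE₀.mul_const u)

theorem norm_mul_pow_le {q : ℂ} (hq : ‖q‖ < 1) (a : ℂ) (M : ℕ) : ‖a * q ^ M‖ ≤ ‖a‖ := by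
  rw [norm_mul, norm_pow]
  exact mul_le_of_le_one_right (norm_nonneg _) (pow_le_one₀ (norm_nonneg _) hq.le)

theorem tendsto_mul_pow {q : ℂ} (hq : ‖q‖ < 1) (a : ℂ) :
    Tendsto (fun M : ℕ => a * q ^ M) atTop (𝓝 0) := by
  simpa using (tendsto_pow_atTop_nhds_zero_of_norm_lt_one hq).const_mul a

/-- Both orders of `u, v` give the same coefficients and the same inhomogeneous term `-auv`, which
cancels in the difference. -/
theorem newtonDiff_recurrence {q a b c d u v : ℂ} (hq0 : q ≠ 0) (hq : ‖q‖ < 1) (hu : u ≠ 0)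
    (hv : v ≠ 0) (h : Admissible q a b c d u v) :
    (1 - a * u) * (1 - a * v) * (1 - a * b * c * d * u ^ 2 * v ^ 2 / q) * newtonDiff q a b c d u v =
      (1 - a * b * u * v) * (1 - a * c * u * v) * (1 - a * d * u * v)
        * newtonDiff q (a * q) b c d u v := by
  have haq : ‖a * q‖ ≤ ‖a‖ := by simpa using norm_mul_pow_le hq a 1
  have h' := h.mono haq le_rfl le_rfl le_rfl
  have aux : ∀ {u v : ℂ}, u ≠ 0 → v ≠ 0 → Admissible q a b c d u v →
      Admissible q (a * q) b c d u v →
      (1 - a * u) * (1 - a * v) * (1 - a * b * c * d * u ^ 2 * v ^ 2 / q) *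
        (v * ∑' N, newtonTerm q (a * v) (b * v) (c * v) (d * v) (u / v) N) -
      (1 - a * b * u * v) * (1 - a * c * u * v) * (1 - a * d * u * v) *
        (v * ∑' N, newtonTerm q (a * q * v) (b * v) (c * v) (d * v) (u / v) N) =
      -(a * u * v) := by
    intro u v hu hv h h'
    have hs' := h'.summable_newtonTerm hq hv
    have e0 : a * q * v = a * v * q := by ring
    rw [e0] at hs' ⊢
    have hrec := newtonTerm_recurrence hq0 hq h.av h.bv h.cv (div_ne_zero hu hv) (d * v)
      (h.summable_newtonTerm hq hv) hs'
    have e1 : ∀ y : ℂ, y * v * (u / v) = y * u := fun y => by field_simp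
    have e2 : a * v * (b * v) * (c * v) * (d * v) * (u / v) ^ 2 / q =
        a * b * c * d * u ^ 2 * v ^ 2 / q := by field_simp
    have e3 : ∀ y z : ℂ, y * v * (z * v) * (u / v) = y * z * u * v := fun y z => by field_simp
    rw [e1, e2, e3, e3, e3] at hrec
    linear_combination v * hrec
  have h1 := aux hu hv h h'
  have h2 := aux hv hu h.swap h'.swap
  rw [newtonDiff, newtonDiff]
  have e : a * b * c * d * v ^ 2 * u ^ 2 / q = a * b * c * d * u ^ 2 * v ^ 2 / q := by ring
  rw [e] at h2
  linear_combination h1 - h2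

theorem newtonDiff_zero_zero_recurrence {q c d u v : ℂ} (hq : ‖q‖ < 1) (hu : u ≠ 0)
    (hv : v ≠ 0) (h : Admissible q 0 0 c d u v) :
    (1 - c * u) * (1 - c * v) * newtonDiff q 0 0 c d u v =
      (1 - c * d * u * v) * newtonDiff q 0 0 (c * q) d u v := by
  have hcq : ‖c * q‖ ≤ ‖c‖ := by simpa using norm_mul_pow_le hq c 1
  have h' := h.mono le_rfl le_rfl hcq le_rfl
  have aux : ∀ {u v : ℂ}, u ≠ 0 → v ≠ 0 → Admissible q 0 0 c d u v →
      Admissible q 0 0 (c * q) d u v →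
      (1 - c * u) * (1 - c * v) *
        (v * ∑' N, newtonTerm q 0 0 (c * v) (d * v) (u / v) N) -
      (1 - c * d * u * v) *
        (v * ∑' N, newtonTerm q 0 0 (c * q * v) (d * v) (u / v) N) = -(c * u * v) := by
    intro u v hu hv h h'
    have hs := h.summable_newtonTerm hq hv
    have hs' := h'.summable_newtonTerm hq hv
    have e0 : c * q * v = c * v * q := by ring
    rw [zero_mul] at hs hs'
    rw [e0] at hs' ⊢
    have hrec := newtonTerm_zero_zero_recurrence hq h.cv (div_ne_zero hu hv) (d * v) hs hs'
    have e1 : c * v * (u / v) = c * u := by field_simp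
    have e3 : c * v * (d * v) * (u / v) = c * d * u * v := by field_simp
    rw [e1, e3] at hrec
    linear_combination v * hrec
  have h1 := aux hu hv h h'
  have h2 := aux hv hu h.swap h'.swap
  rw [newtonDiff, newtonDiff]
  simp only [zero_mul]
  linear_combination h1 - h2

theorem newtonDiff_zero_zero_zero_recurrence {q d u v : ℂ} (hu : u ≠ 0) (hv : v ≠ 0)
    (h : ∀ M : ℕ, Summable (newtonTerm q 0 0 0 (d * q ^ M * v) (u / v)))
    (h' : ∀ M : ℕ, Summable (newtonTerm q 0 0 0 (d * q ^ M * u) (v / u))) (M : ℕ) :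
    (1 - d * u * q ^ M) * (1 - d * v * q ^ M) * newtonDiff q 0 0 0 (d * q ^ M) u v =
      1 * newtonDiff q 0 0 0 (d * q ^ (M + 1)) u v := by
  have aux : ∀ {u v : ℂ}, u ≠ 0 → v ≠ 0 →
      (∀ M : ℕ, Summable (newtonTerm q 0 0 0 (d * q ^ M * v) (u / v))) →
      (1 - d * u * q ^ M) * (1 - d * v * q ^ M) *
        (v * ∑' N, newtonTerm q 0 0 0 (d * q ^ M * v) (u / v) N) -
        v * ∑' N, newtonTerm q 0 0 0 (d * q ^ (M + 1) * v) (u / v) N = -(d * q ^ M * u * v) := by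
    intro u v hu hv h
    have hs' := h (M + 1)
    have e0 : d * q ^ (M + 1) * v = d * q ^ M * v * q := by ring
    rw [e0] at hs' ⊢
    have hrec := newtonTerm_zero_zero_zero_recurrence (div_ne_zero hu hv) _ (h M) hs'
    have e1 : d * q ^ M * v * (u / v) = d * q ^ M * u := by field_simp
    rw [e1] at hrec
    linear_combination v * hrec
  have h1 := aux hu hv h
  have h2 := aux hv hu h'
  rw [newtonDiff, newtonDiff]
  simp only [zero_mul]
  linear_combination h1 - h2

theorem newtonDiff_eq_zero_left {q a b c d u v : ℂ} (hq0 : q ≠ 0) (hq : ‖q‖ < 1) (hu : u ≠ 0)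
    (hv : v ≠ 0) (h : Admissible q a b c d u v) :
    qPochInf (a * u) q * qPochInf (a * v) q * qPochInf (a * b * c * d * u ^ 2 * v ^ 2 / q) q
        * newtonDiff q a b c d u v =
      qPochInf (a * b * u * v) q * qPochInf (a * c * u * v) q * qPochInf (a * d * u * v) q
        * newtonDiff q 0 b c d u v := by
  have hlim := tendsto_newtonDiff hq hu hv h (norm_mul_pow_le hq a) (fun _ => le_rfl)
    (fun _ => le_rfl) (fun _ => le_rfl) (tendsto_mul_pow hq a) tendsto_const_nhds
    tendsto_const_nhds tendsto_const_nhds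
  have key := mul_eq_mul_of_recurrence
    (f := fun M => (1 - a * u * q ^ M) * (1 - a * v * q ^ M)
      * (1 - a * b * c * d * u ^ 2 * v ^ 2 / q * q ^ M))
    (g := fun M => (1 - a * b * u * v * q ^ M) * (1 - a * c * u * v * q ^ M)
      * (1 - a * d * u * v * q ^ M)) (fun M => ?_)
    (by
      simp only [Finset.prod_mul_distrib]
      exact ((tendsto_qPoch_qPochInf _ hq).mul (tendsto_qPoch_qPochInf _ hq)).mul
        (tendsto_qPoch_qPochInf _ hq))
    (by
      simp only [Finset.prod_mul_distrib]
      exact ((tendsto_qPoch_qPochInf _ hq).mul (tendsto_qPoch_qPochInf _ hq)).mul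
        (tendsto_qPoch_qPochInf _ hq)) hlim
  · simpa using key
  · have hrec := newtonDiff_recurrence hq0 hq hu hv
      (h.mono (norm_mul_pow_le hq a M) le_rfl le_rfl le_rfl)
    have e : a * q ^ M * q = a * q ^ (M + 1) := by ring
    rw [e] at hrec
    convert hrec using 2 <;> ring

theorem newtonDiff_zero_zero_eq {q c d u v : ℂ} (hq : ‖q‖ < 1) (hu : u ≠ 0)
    (hv : v ≠ 0) (h : Admissible q 0 0 c d u v) :
    qPochInf (c * u) q * qPochInf (c * v) q * newtonDiff q 0 0 c d u v =
      qPochInf (c * d * u * v) q * newtonDiff q 0 0 0 d u v := by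
  have hlim := tendsto_newtonDiff hq hu hv h (fun _ => le_rfl) (fun _ => le_rfl)
    (norm_mul_pow_le hq c) (fun _ => le_rfl) tendsto_const_nhds tendsto_const_nhds
    (tendsto_mul_pow hq c) tendsto_const_nhds
  have key := mul_eq_mul_of_recurrence
    (f := fun M => (1 - c * u * q ^ M) * (1 - c * v * q ^ M))
    (g := fun M => 1 - c * d * u * v * q ^ M) (fun M => ?_)
    (by
      simp only [Finset.prod_mul_distrib]
      exact (tendsto_qPoch_qPochInf _ hq).mul (tendsto_qPoch_qPochInf _ hq))
    (tendsto_qPoch_qPochInf _ hq) hlim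
  · simpa using key
  · have hrec := newtonDiff_zero_zero_recurrence hq hu hv
      (h.mono le_rfl le_rfl (norm_mul_pow_le hq c M) le_rfl)
    have e : c * q ^ M * q = c * q ^ (M + 1) := by ring
    rw [e] at hrec
    convert hrec using 2 <;> ring

/-- Only summability is assumed, not `‖dv‖ < 1`: the evaluation of the constant uses `d = q/u`, for
which `dv` may be large although the series terminates. -/
theorem newtonDiff_zero_zero_zero_eq {q d u v : ℂ} (hq : ‖q‖ < 1) (hu : u ≠ 0) (hv : v ≠ 0)
    (h : ∀ M : ℕ, Summable (newtonTerm q 0 0 0 (d * q ^ M * v) (u / v)))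
    (h' : ∀ M : ℕ, Summable (newtonTerm q 0 0 0 (d * q ^ M * u) (v / u))) :
    qPochInf (d * u) q * qPochInf (d * v) q * newtonDiff q 0 0 0 d u v =
      newtonDiff q 0 0 0 0 u v := by
  have hsmall : ∀ w : ℂ, ∀ᶠ M : ℕ in atTop, ‖d * q ^ M * w‖ < 1 := fun w => by
    have := ((tendsto_mul_pow hq d).mul_const w).norm
    rw [zero_mul, norm_zero] at this
    exact this.eventually_lt_const one_pos
  -- From index `M₀` on, `d q^M` is small enough for dominated convergence; the limit ignores the
  -- earlier indices.
  obtain ⟨M₀, hM₁, hM₂⟩ := ((hsmall u).and (hsmall v)).exists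
  have hadm : Admissible q 0 0 0 (d * q ^ M₀) u v := by
    refine ⟨?_, ?_, ?_, ?_, ?_, ?_, hM₁, hM₂, ?_⟩ <;> simp
  have hlim := tendsto_newtonDiff hq hu hv hadm (fun _ => le_rfl) (fun _ => le_rfl)
    (fun _ => le_rfl) (norm_mul_pow_le hq _) tendsto_const_nhds tendsto_const_nhds
    tendsto_const_nhds (tendsto_mul_pow hq _)
  have hlim' : Tendsto (fun M : ℕ => newtonDiff q 0 0 0 (d * q ^ M) u v) atTop
      (𝓝 (newtonDiff q 0 0 0 0 u v)) := by
    refine (tendsto_add_atTop_iff_nat M₀).1 (hlim.congr fun M => ?_)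
    rw [mul_assoc, ← pow_add, add_comm]
  have key := mul_eq_mul_of_recurrence
    (f := fun M => (1 - d * u * q ^ M) * (1 - d * v * q ^ M)) (g := fun _ => 1)
    (newtonDiff_zero_zero_zero_recurrence hu hv h h')
    (by
      simp only [Finset.prod_mul_distrib]
      exact (tendsto_qPoch_qPochInf _ hq).mul (tendsto_qPoch_qPochInf _ hq))
    (B := 1) (by simp) hlim'
  simpa using key

/-! ### The constant `Δ(u, v)` and the closed form -/

theorem homPoch_eq_zero {x y q : ℂ} {k n : ℕ} (h : x = y * q ^ k) (hk : k < n) :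
    homPoch x y q n = 0 :=
  Finset.prod_eq_zero (Finset.mem_range.2 hk) (sub_eq_zero.2 h)

/-- At `d = q/u` the first series has `D = dv` at the node `q/x` and reduces to `1`. The second has
terms `q^N (u/v; q)_N`, and `u/v` times its sum telescopes to `1 - (u/v; q)_∞`. The difference is
thus `v (u/v; q)_∞`, and `(du, dv; q)_∞ = (q, qv/u; q)_∞` supplies the rest of `Δ`. -/
theorem newtonDiff_zero_eq_thetaDelta {q u v : ℂ} (hq : ‖q‖ < 1) (hu : u ≠ 0) (hv : v ≠ 0) :
    newtonDiff q 0 0 0 0 u v = thetaDelta q u v := by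
  have hnode : q / (u / v) = q / u * v := by field_simp
  have hqu : q / u * u = q := div_mul_cancel₀ q hu
  rw [← newtonDiff_zero_zero_zero_eq (d := q / u) hq hu hv, hqu]
  · have h1 : ∑' N, newtonTerm q 0 0 0 (q / u * v) (u / v) N = 1 := by
      rw [tsum_eq_single 0]
      · simp [newtonTerm_zero_zero_zero, homPoch_zero]
      · intro N hN
        rw [newtonTerm_zero_zero_zero, hnode]
        exact homPoch_eq_zero (k := 0) (by simp) (Nat.pos_of_ne_zero hN)
    have h2 : u / v * ∑' N, newtonTerm q 0 0 0 q (v / u) N = 1 - qPochInf (u / v) q := by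
      have hterm : ∀ N, newtonTerm q 0 0 0 q (v / u) N = q ^ N * qPoch (u / v) q N := by
        intro N
        have e : homPoch q (q / (v / u)) q N = homPoch (q * 1) (q * (u / v)) q N := by
          congr 1 <;> field_simp
        rw [newtonTerm_zero_zero_zero, e, homPoch_mul_left]
        rfl
      have hsum : Summable (newtonTerm q 0 0 0 q (v / u)) :=
        summable_newtonTerm hq (by simp) (by simp) (by simp) hq (by simp)
      have h3 := (hsum.hasSum.mul_left (u / v)).tendsto_sum_nat
      have h4 : ∀ n, ∑ N ∈ range n, u / v * newtonTerm q 0 0 0 q (v / u) N =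
          1 - qPoch (u / v) q n := by
        intro n
        induction n with
        | zero => simp [qPoch_zero]
        | succ n ih =>
          rw [Finset.sum_range_succ, ih, hterm, qPoch_succ]
          ring
      simp only [h4] at h3
      exact tendsto_nhds_unique h3 ((tendsto_qPoch_qPochInf _ hq).const_sub 1)
    have h5 : newtonDiff q 0 0 0 (q / u) u v = v * qPochInf (u / v) q := by
      rw [newtonDiff]
      simp only [zero_mul, h1, hqu]
      have h6 : u = v * (u / v) := by field_simp
      nth_rewrite 1 [h6]
      linear_combination -v * h2
    have h7 : q * v / u = q / u * v := by ring
    rw [h5, thetaDelta, h7]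
    simp only [qPochsInf, List.map_cons, List.map_nil, List.prod_cons, List.prod_nil]
    ring
  · intro M
    -- For `d = q^{M+1}/u` the factor of index `M` vanishes, so only terms with `N ≤ M` can survive.
    refine summable_of_ne_finset_zero (s := range (M + 1)) fun N hN => ?_
    rw [newtonTerm_zero_zero_zero, hnode]
    refine homPoch_eq_zero (k := M) (by ring) ?_
    rw [Finset.mem_range] at hN
    omega
  · intro M
    refine summable_newtonTerm hq (by simp) (by simp) (by simp) ?_ (by simp)
    rw [mul_right_comm, hqu]
    exact (norm_mul_pow_le hq q M).trans_lt hq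

/-- The antisymmetrized Newton expansion in closed form. -/
theorem newtonDiff_eq {q a b c d u v : ℂ} (hq0 : q ≠ 0) (hq : ‖q‖ < 1) (hu : u ≠ 0)
    (hv : v ≠ 0) (h : Admissible q a b c d u v) :
    newtonDiff q a b c d u v = thetaDelta q u v
      * qPochsInf [a * b * u * v, a * c * u * v, a * d * u * v,
          b * c * u * v, b * d * u * v, c * d * u * v] q
      / qPochsInf [a * u, a * v, b * u, b * v, c * u, c * v, d * u, d * v,
          a * b * c * d * u ^ 2 * v ^ 2 / q] q := by
  have hb : Admissible q 0 b c d u v := h.mono (by simp) le_rfl le_rfl le_rfl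
  have hb' : Admissible q b 0 c d u v :=
    ⟨hb.bu, hb.bv, hb.au, hb.av, hb.cu, hb.cv, hb.du, hb.dv, by simp⟩
  have hc : Admissible q 0 0 c d u v := hb.mono le_rfl (by simp) le_rfl le_rfl
  have hd : ∀ M : ℕ, Admissible q 0 0 0 (d * q ^ M) u v := fun M =>
    hc.mono le_rfl le_rfl (by simp) (norm_mul_pow_le hq d M)
  have h1 := newtonDiff_eq_zero_left hq0 hq hu hv h
  have h2 := newtonDiff_eq_zero_left hq0 hq hu hv hb'
  have h3 := newtonDiff_zero_zero_eq hq hu hv hc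
  have h4 := newtonDiff_zero_zero_zero_eq (d := d) hq hu hv
    (fun M => by simpa using (hd M).summable_newtonTerm hq hv)
    (fun M => by simpa using (hd M).swap.summable_newtonTerm hq hu)
  have hone : qPochInf 0 q = 1 := by simp [qPochInf]
  -- `h2` was obtained with `b` in first place and `0` in second; the swap turns its left side into
  -- the right side of `h1`. Products with argument `0` then drop out.
  rw [newtonDiff_swap] at h2
  simp only [mul_zero, zero_mul, zero_div, hone, mul_one, one_mul] at h2
  rw [newtonDiff_zero_eq_thetaDelta hq hu hv] at h4
  have n1 := qPochInf_ne_zero hq h.au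
  have n2 := qPochInf_ne_zero hq h.av
  have n3 := qPochInf_ne_zero hq h.bu
  have n4 := qPochInf_ne_zero hq h.bv
  have n5 := qPochInf_ne_zero hq h.cu
  have n6 := qPochInf_ne_zero hq h.cv
  have n7 := qPochInf_ne_zero hq h.du
  have n8 := qPochInf_ne_zero hq h.dv
  have n9 := qPochInf_ne_zero hq h.abcd
  simp only [qPochsInf, List.map_cons, List.map_nil, List.prod_cons, List.prod_nil, mul_one]
  rw [eq_div_iff (by simp [n1, n2, n3, n4, n5, n6, n7, n8, n9]), ← h4]
  linear_combination (qPochInf (b * u) q * qPochInf (b * v) q * qPochInf (c * u) q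
      * qPochInf (c * v) q * qPochInf (d * u) q * qPochInf (d * v) q) * h1
    + (qPochInf (a * b * u * v) q * qPochInf (a * c * u * v) q * qPochInf (a * d * u * v) q
      * qPochInf (c * u) q * qPochInf (c * v) q * qPochInf (d * u) q * qPochInf (d * v) q) * h2
    + (qPochInf (a * b * u * v) q * qPochInf (a * c * u * v) q * qPochInf (a * d * u * v) q
      * qPochInf (b * c * u * v) q * qPochInf (b * d * u * v) q
      * qPochInf (d * u) q * qPochInf (d * v) q) * h3

/-! ### From `ρ` to the Newton expansion -/

/-- This is where `r = duv` enters: up to `u^k`, the product continues `(q/du; q)_n (dv)^n` at index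
`n`. The power `u^k` is absorbed by the argument of the inner series. -/
theorem homPoch_duv {u : ℂ} (hu : u ≠ 0) (q d v : ℂ) (n k : ℕ) :
    homPoch (d * u * v) (v * q ^ (n + 1)) q k =
      u ^ k * homPoch (d * v) (q * v / u * q ^ n) q k := by
  rw [← homPoch_mul_left]
  congr 1
  · ring
  · field_simp
    ring

theorem rhoExtInnerTerm_eq_pairTerm {q u v : ℂ} (hu : u ≠ 0) (hv : v ≠ 0)
    (a b c d : ℂ) (n k : ℕ) :
    homPoch (d * v) (q * v / u) q n * qPochs [a * c * u * v, b * c * u * v] q n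
        / qPochs [a * v, b * v, c * v] q (n + 1) * rhoExtInnerTerm q a b c (d * u * v) u v n k =
      pairTerm q (a * v) (b * v) (c * v) (d * v) (u / v) (n, k) := by
  have e1 : a * v * (c * v) * (u / v) = a * c * u * v := by field_simp
  have e2 : b * v * (c * v) * (u / v) = b * c * u * v := by field_simp
  have e3 : c * v * (u / v) = c * u := by field_simp
  have e4 : q / (u / v) = q * v / u := by field_simp
  have e5 : a * v * (b * v) * (u / v) / q = u * (a * b * v / q) := by field_simp
  have e6 : ∀ y : ℂ, qPoch (y * v) q (n + k + 1) =
      qPoch (y * v) q (n + 1) * qPoch (y * v * q ^ (n + 1)) q k := fun y => by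
    rw [← qPoch_add, add_right_comm]
  simp only [rhoExtInnerTerm, pairTerm, newtonSummand, e1, e2, e3, e4, e5, e6, homPoch_duv hu,
    qPochs, List.map_cons, List.map_nil, List.prod_cons, List.prod_nil, gaussBinom,
    homPoch_add (d * v), mul_pow]
  simp only [div_eq_mul_inv, mul_inv]
  ring

/-- Summability of `pairTerm` does not suffice here: its prefactor `(q/du; q)_n (dv)^n` vanishes for
large `n` when `du` is a positive power of `q`. The inner series is therefore bounded directly, with
the same radii. -/
theorem summable_rhoExtInnerTerm {q a b c d u v : ℂ} (hq : ‖q‖ < 1) (hu : u ≠ 0) (hv : v ≠ 0)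
    (h : Admissible q a b c d u v) (n : ℕ) :
    Summable (rhoExtInnerTerm q a b c (d * u * v) u v n) := by
  obtain ⟨s, t, hs0, hs1, ht0, hDs, hct, hst⟩ := exists_radii h.dv (h.prod_lt_one hv)
  have e3 : c * v * (u / v) = c * u := by field_simp
  have e5 : a * v * (b * v) * (u / v) / q = u * (a * b * v / q) := by field_simp
  rw [e3] at hct
  rw [e5, norm_mul] at hst
  have hle : ∀ {y : ℂ}, ‖y * v‖ < 1 → ‖y * v * q ^ (n + 1)‖ ≤ ‖y * v‖ := fun _ =>
    norm_mul_pow_le hq _ _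
  refine .of_norm_bounded ((summable_geometric_of_lt_one (by positivity) hst).mul_left
    (Real.exp (1 / (1 - ‖q‖)) * Real.exp (‖q‖ / (1 - ‖q‖) / (1 - ‖q‖))
      * Real.exp (‖q * v / u * q ^ n‖ / s / (1 - ‖q‖)) * Real.exp (‖q‖ / t / (1 - ‖q‖))
      * (Real.exp (‖a * v‖ / (1 - ‖a * v‖) / (1 - ‖q‖))
        * Real.exp (‖b * v‖ / (1 - ‖b * v‖) / (1 - ‖q‖))))) fun k => ?_
  have hk : rhoExtInnerTerm q a b c (d * u * v) u v n k =
      gaussBinom q n k * (u ^ k * homPoch (d * v) (q * v / u * q ^ n) q k) * homPoch (c * u) q q k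
        * ((qPoch (a * v * q ^ (n + 1)) q k)⁻¹ * (qPoch (b * v * q ^ (n + 1)) q k)⁻¹)
        * (a * b * v / q) ^ k := by
    simp only [rhoExtInnerTerm, homPoch_duv hu, qPochs, List.map_cons, List.map_nil,
      List.prod_cons, List.prod_nil, gaussBinom]
    simp only [div_eq_mul_inv, mul_inv]
    ring
  have hnorm : ∀ g w h₁ h₂ i₁ i₂ z : ℂ, ‖g * (w ^ k * h₁) * h₂ * (i₁ * i₂) * z ^ k‖ =
      ‖g‖ * (‖w‖ ^ k * ‖h₁‖) * ‖h₂‖ * (‖i₁‖ * ‖i₂‖) * ‖z‖ ^ k := by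
    intros
    simp only [norm_mul, norm_pow]
  rw [hk, hnorm]
  calc _ ≤ Real.exp (1 / (1 - ‖q‖)) * Real.exp (‖q‖ / (1 - ‖q‖) / (1 - ‖q‖))
        * (‖u‖ ^ k * (s ^ k * Real.exp (‖q * v / u * q ^ n‖ / s / (1 - ‖q‖))))
        * (t ^ k * Real.exp (‖q‖ / t / (1 - ‖q‖)))
        * (Real.exp (‖a * v‖ / (1 - ‖a * v‖) / (1 - ‖q‖))
          * Real.exp (‖b * v‖ / (1 - ‖b * v‖) / (1 - ‖q‖))) * ‖a * b * v / q‖ ^ k := by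
        gcongr
        · exact norm_gaussBinom_le hq n k
        · exact norm_homPoch_le hs0 hq hDs _ _
        · exact norm_homPoch_le ht0 hq hct _ _
        · exact norm_qPoch_inv_le h.av hq (hle h.av) k
        · exact norm_qPoch_inv_le h.bv hq (hle h.bv) k
    _ = _ := by
        rw [mul_pow, mul_pow, mul_pow]
        ring

theorem rhoExtTerm_eq_tsum_pairTerm {q u v : ℂ} (hu : u ≠ 0) (hv : v ≠ 0) (a b c d : ℂ) :
    rhoExtTerm q a b c d (d * u * v) u v =
      fun n => ∑' k, pairTerm q (a * v) (b * v) (c * v) (d * v) (u / v) (n, k) := by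
  funext n
  rw [rhoExtTerm, ← tsum_mul_left]
  exact tsum_congr fun k => rhoExtInnerTerm_eq_pairTerm hu hv a b c d n k

theorem summable_rhoExtTerm {q a b c d u v : ℂ} (hq : ‖q‖ < 1) (hu : u ≠ 0) (hv : v ≠ 0)
    (h : Admissible q a b c d u v) : Summable (rhoExtTerm q a b c d (d * u * v) u v) := by
  rw [rhoExtTerm_eq_tsum_pairTerm hu hv]
  exact (summable_pairTerm hq h.av h.bv h.cv h.dv (h.prod_lt_one hv)).prod

theorem rhoExt_eq_newton {q a b c d u v : ℂ} (hq : ‖q‖ < 1) (hu : u ≠ 0) (hv : v ≠ 0)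
    (h : Admissible q a b c d u v) :
    rhoExt q a b c d (d * u * v) u v =
      v * ∑' N, newtonTerm q (a * v) (b * v) (c * v) (d * v) (u / v) N := by
  rw [rhoExt, rhoExtTerm_eq_tsum_pairTerm hu hv,
    tsum_pairTerm (summable_pairTerm hq h.av h.bv h.cv h.dv (h.prod_lt_one hv))]

theorem mainTheorem4 (q a b c d u v : ℂ)
    (hq0 : q ≠ 0) (hq1 : ‖q‖ < 1) (huv : u * v ≠ 0)
    (hau : ‖a * u‖ < 1) (hav : ‖a * v‖ < 1) (hbu : ‖b * u‖ < 1) (hbv : ‖b * v‖ < 1)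
    (hcu : ‖c * u‖ < 1) (hcv : ‖c * v‖ < 1) (hdu : ‖d * u‖ < 1) (hdv : ‖d * v‖ < 1)
    (habcd : ‖a * b * c * d * u ^ 2 * v ^ 2 / q‖ < 1) :
    -- the literal series, for nonzero `c` and `d`
    (c ≠ 0 → d ≠ 0 →
      (∀ n, Summable (rhoInnerTerm q a b c (d * u * v) u v n)) ∧
      Summable (rhoTerm q a b c d (d * u * v) u v) ∧
      (∀ n, Summable (rhoInnerTerm q a b c (d * u * v) v u n)) ∧
      Summable (rhoTerm q a b c d (d * u * v) v u) ∧
      rho q a b c d (d * u * v) u v - rho q a b c d (d * u * v) v u =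
        thetaDelta q u v
          * qPochsInf [a * b * u * v, a * c * u * v, a * d * u * v,
              b * c * u * v, b * d * u * v, c * d * u * v] q
          / qPochsInf [a * u, a * v, b * u, b * v, c * u, c * v, d * u, d * v,
              a * b * c * d * u ^ 2 * v ^ 2 / q] q) ∧
    -- all `c` and `d`, with the limit values of the terms where `c = 0` or `d = 0`
    ((∀ n, Summable (rhoExtInnerTerm q a b c (d * u * v) u v n)) ∧
      Summable (rhoExtTerm q a b c d (d * u * v) u v) ∧
      (∀ n, Summable (rhoExtInnerTerm q a b c (d * u * v) v u n)) ∧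
      Summable (rhoExtTerm q a b c d (d * u * v) v u) ∧
      rhoExt q a b c d (d * u * v) u v - rhoExt q a b c d (d * u * v) v u =
        thetaDelta q u v
          * qPochsInf [a * b * u * v, a * c * u * v, a * d * u * v,
              b * c * u * v, b * d * u * v, c * d * u * v] q
          / qPochsInf [a * u, a * v, b * u, b * v, c * u, c * v, d * u, d * v,
              a * b * c * d * u ^ 2 * v ^ 2 / q] q) := by
  have hu : u ≠ 0 := left_ne_zero_of_mul huv
  have hv : v ≠ 0 := right_ne_zero_of_mul huv
  have h : Admissible q a b c d u v := ⟨hau, hav, hbu, hbv, hcu, hcv, hdu, hdv, habcd⟩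
  have hr : d * u * v = d * v * u := by ring
  have hinner := summable_rhoExtInnerTerm hq1 hu hv h
  have hinner' := summable_rhoExtInnerTerm hq1 hv hu h.swap
  have houter := summable_rhoExtTerm hq1 hu hv h
  have houter' := summable_rhoExtTerm hq1 hv hu h.swap
  have heq := newtonDiff_eq hq0 hq1 hu hv h
  rw [newtonDiff, ← rhoExt_eq_newton hq1 hu hv h, ← rhoExt_eq_newton hq1 hv hu h.swap] at heq
  rw [← hr] at hinner' houter' heq
  refine ⟨fun hc hd => ?_, hinner, houter, hinner', houter', heq⟩
  have hr0 : d * u * v ≠ 0 := mul_ne_zero (mul_ne_zero hd hu) hv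
  have hI : ∀ n, rhoInnerTerm q a b c (d * u * v) u v n =
      rhoExtInnerTerm q a b c (d * u * v) u v n := fun n =>
    funext fun k => (rhoExtInnerTerm_eq hc hr0 hu q a b v n k).symm
  have hI' : ∀ n, rhoInnerTerm q a b c (d * u * v) v u n =
      rhoExtInnerTerm q a b c (d * u * v) v u n := fun n =>
    funext fun k => (rhoExtInnerTerm_eq hc hr0 hv q a b u n k).symm
  have hO : rhoTerm q a b c d (d * u * v) u v = rhoExtTerm q a b c d (d * u * v) u v :=
    funext fun n => (rhoExtTerm_eq hc hd hr0 hu hv q a b n).symm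
  have hO' : rhoTerm q a b c d (d * u * v) v u = rhoExtTerm q a b c d (d * u * v) v u :=
    funext fun n => (rhoExtTerm_eq hc hd hr0 hv hu q a b n).symm
  refine ⟨fun n => ?_, ?_, fun n => ?_, ?_, ?_⟩
  · rw [hI]
    exact hinner n
  · rw [hO]
    exact houter
  · rw [hI']
    exact hinner' n
  · rw [hO']
    exact houter'
  · rw [← rhoExt_eq hc hd hr0 hu hv, ← rhoExt_eq hc hd hr0 hv hu]
    exact heq
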